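/- Let $K$ be a field and let $(V,c)$ be a braided vector space over $K$, i.e. $V$ is a $K$-vector space (of arbitrary dimension) and $c:V\otimes V\to V\otimes V$ is a $K$-linear map (not necessarily invertible) with $c_1c_2c_1=c_2c_1c_2$ on $V^{\otimes 3}$, where $c_1=c\otimes V$ and $c_2=V\otimes c$. Let $T=T(V,c)$ be the tensor algebra of $V$ with its induced braiding $c_T$ and with the comultiplication $\Delta_T$ that makes it a graded braided bialgebra with $\Delta_T(v)=v\otimes1+1\otimes v$ for $v\in V$, and let $\Delta_T^{p,q}:V^{\otimes(p+q)}\to V^{\otimes p}\otimes V^{\otimes q}$ be its homogeneous components. Put $E(V,c)=\bigoplus_{n\ge2}E_n(V,c)$ with $E_n(V,c)=\bigcap_{p,q\ge1,\,p+q=n}\ker\Delta_T^{p,q}$; in particular $E_2(V,c)=\ker(c+\mathrm{Id}_{V\otimes V})$. The braiding $c_T$ restricts to maps $c_{E,V}:E(V,c)\otimes V\to V\otimes E(V,c)$ and $c_{V,E}:V\otimes E(V,c)\to E(V,c)\otimes V$, and similarly to $c_{E_2,V}$ and $c_{V,E_2}$ for $E_2=E_2(V,c)$. A *bracket* on $(V,c)$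 is a $K$-linear map $b:E(V,c)\to V$ with $c(b\otimes V)=(V\otimes b)c_{E,V}$ and $c(V\otimes b)=(b\otimes V)c_{V,E}$. Its *universal enveloping algebra* is $$U(V,c,b)=T(V,c)/\big((\mathrm{Id}-b)[E(V,c)]\big),$$ the quotient by the two-sided ideal generated by all $z-b(z)$, $z\in E(V,c)$. The triple $(V,c,b)$ is a *braided Lie algebra* if $b$ is a bracket and the canonical map $V\to U(V,c,b)$ is injective. A *quadratic bracket* is a $K$-linear map $\beta:E_2(V,c)\to V$ with $c(\beta\otimes V)=(V\otimes\beta)c_{E_2,V}$ and $c(V\otimes\beta)=(\beta\otimes V)c_{V,E_2}$. Then $(\beta\otimes V-V\otimes\beta)(z)\in E_2(V,c)$ for all $z\in(E_2\otimes V)\cap(V\otimes E_2)$; $(V,c,\beta)$ is a *quadratic Lie algebra* if moreover $\beta\big((\beta\otimes V-V\otimes\beta)(z)\big)=0$ for all such $z$. Its quadratic universal enveloping algebra is $U_Q(V,c,\beta)=T(V,c)/\big((\mathrm{Id}-\beta)[E_2(V,c)]\big)$. The *Nichols algebra* of $(V,c)$ is the graded algebra $B(V,c)=T(V,c)/\ker\Gamma\simeq\mathrm{Im}\,\Gamma$,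 where $\Gamma$ is the algebra homomorphism from $T(V,c)$ to the quantum shuffle algebra of $(V,c)$ that is the identity on $V$. A graded $K$-algebra $A=\bigoplus_{n\in\mathbb N}A^n$ is *quadratic* if $A^0=K$, the natural map $\pi:T_K(A^1)\to A$ is surjective, and $\ker\pi$ is generated as a two-sided ideal by $\ker\pi\cap(A^1\otimes A^1)$. **Theorem.** Let $(V,c,b)$ be a braided Lie algebra such that $B(V,c)$ is a quadratic algebra, and let $b^2:E_2(V,c)\to V$ be the restriction of $b$. Then $(V,c,b^2)$ is a quadratic Lie algebra, and $$U(V,c,b)=U_Q(V,c,b^2)$$ as quotients of $T(V,c)$; that is, the two-sided ideals generated by $(\mathrm{Id}-b)[E(V,c)]$ and by $(\mathrm{Id}-b^2)[E_2(V,c)]$ coincide, and hence there is an algebra isomorphism $U_Q(V,c,b^2)\cong U(V,c,b)$ compatible with the projections from $T(V,c)$. -/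

import Mathlib

section

open scoped TensorProduct

namespace TensorAlgebra

variable {K : Type*} [Field K] {V : Type*} [AddCommGroup V] [Module K V]
variable {M : Type*} [AddCommGroup M] [Module K M]

/-- Left recursion on the tensor algebra: the linear map `F : T(V) → M` with `F 1 = m` and
`F (v * x) = s v (F x)` for `v ∈ V`. -/
noncomputable def leftRec (s : V →ₗ[K] Module.End K M) (m : M) : TensorAlgebra K V →ₗ[K] M :=
  LinearMap.applyₗ m ∘ₗ (TensorAlgebra.lift K s).toLinearMap

@[simp]
theorem leftRec_one (s : V →ₗ[K] Module.End K M) (m : M) : leftRec s m 1 = m := by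
  simp [leftRec]

@[simp]
theorem leftRec_ι_mul (s : V →ₗ[K] Module.End K M) (m : M) (v : V) (x : TensorAlgebra K V) :
    leftRec s m (ι K v * x) = s v (leftRec s m x) := by
  simp [leftRec]

theorem left_induction {P : TensorAlgebra K V → Prop} (one : P 1)
    (add : ∀ x y, P x → P y → P (x + y)) (smul : ∀ (k : K) x, P x → P (k • x))
    (ι_mul : ∀ v x, P x → P (ι K v * x)) (x : TensorAlgebra K V) : P x := by
  have key : ∀ a : TensorAlgebra K V, ∀ y, P y → P (a * y) := by
    intro a
    induction a using TensorAlgebra.induction with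
    | algebraMap r => intro y hy; rw [← Algebra.smul_def]; exact smul r y hy
    | ι v => exact fun y hy => ι_mul v y hy
    | mul a b ha hb => intro y hy; rw [mul_assoc]; exact ha _ (hb _ hy)
    | add a b ha hb => intro y hy; rw [add_mul]; exact add _ _ (ha _ hy) (hb _ hy)
  simpa using key x 1 one

theorem linearMap_ext {f g : TensorAlgebra K V →ₗ[K] M} (one : f 1 = g 1)
    (ι_mul : ∀ v x, f x = g x → f (ι K v * x) = g (ι K v * x)) : f = g := by
  ext x
  induction x using left_induction with
  | one => exact one
  | add x y hx hy => simp [hx, hy]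
  | smul k x hx => simp [hx]
  | ι_mul v x hx => exact ι_mul v x hx

variable (K V) in
/-- Left multiplication `V ⊗ T(V) → T(V)`, `v ⊗ x ↦ v * x`. -/
noncomputable def lmul : V ⊗[K] TensorAlgebra K V →ₗ[K] TensorAlgebra K V :=
  TensorProduct.lift (LinearMap.mul K (TensorAlgebra K V) ∘ₗ ι K)

@[simp]
theorem lmul_tmul (v : V) (x : TensorAlgebra K V) : lmul K V (v ⊗ₜ x) = ι K v * x := rfl

variable (K V M) in
/-- `V ⊗ (T(V) ⊗ M) → T(V) ⊗ M`, `v ⊗ (x ⊗ m) ↦ (v * x) ⊗ m`. -/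
noncomputable def lmulTensor :
    V ⊗[K] (TensorAlgebra K V ⊗[K] M) →ₗ[K] TensorAlgebra K V ⊗[K] M :=
  (lmul K V).rTensor M ∘ₗ (TensorProduct.assoc K V (TensorAlgebra K V) M).symm.toLinearMap

@[simp]
theorem lmulTensor_tmul (v : V) (x : TensorAlgebra K V) (m : M) :
    lmulTensor K V M (v ⊗ₜ (x ⊗ₜ m)) = (ι K v * x) ⊗ₜ m := by
  simp [lmulTensor]

variable (K V) in
/-- The product `V ⊗ V → T(V)`, i.e. the inclusion of the degree two component. -/
noncomputable def ι₂ : V ⊗[K] V →ₗ[K] TensorAlgebra K V :=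
  lmul K V ∘ₗ (ι K).lTensor V

@[simp]
theorem ι₂_tmul (v w : V) : ι₂ K V (v ⊗ₜ w) = ι K v * ι K w := by simp [ι₂]

variable (K V) in
/-- The degree `n` component `V^{⊗ n}` of the tensor algebra. -/
noncomputable def degPart (n : ℕ) : Submodule K (TensorAlgebra K V) := LinearMap.range (ι K) ^ n

variable (K V) in
/-- The projection of `T(V)` onto its degree `n` component. -/
noncomputable def degProj (n : ℕ) : TensorAlgebra K V →ₗ[K] TensorAlgebra K V :=
  GradedAlgebra.proj (fun n : ℕ => LinearMap.range (ι K : V →ₗ[K] TensorAlgebra K V) ^ n) n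

theorem degProj_of_mem {n : ℕ} {x : TensorAlgebra K V} (hx : x ∈ degPart K V n) :
    degProj K V n x = x :=
  DirectSum.decompose_of_mem_same
    (fun n : ℕ => LinearMap.range (ι K : V →ₗ[K] TensorAlgebra K V) ^ n) hx

theorem degProj_of_mem_ne {n m : ℕ} (h : n ≠ m) {x : TensorAlgebra K V} (hx : x ∈ degPart K V n) :
    degProj K V m x = 0 :=
  DirectSum.decompose_of_mem_ne
    (fun n : ℕ => LinearMap.range (ι K : V →ₗ[K] TensorAlgebra K V) ^ n) hx h

theorem degProj_mem (n : ℕ) (x : TensorAlgebra K V) : degProj K V n x ∈ degPart K V n :=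
  SetLike.coe_mem _

theorem mem_degPart_iff {n : ℕ} {x : TensorAlgebra K V} :
    x ∈ degPart K V n ↔ degProj K V n x = x :=
  ⟨degProj_of_mem, fun h => h ▸ degProj_mem n x⟩

theorem one_mem_degPart : (1 : TensorAlgebra K V) ∈ degPart K V 0 := by
  simp [degPart, Submodule.one_le.mp le_rfl]

theorem ι_mem_degPart (v : V) : ι K v ∈ degPart K V 1 := by
  simp [degPart]

theorem mul_mem_degPart {n m : ℕ} {x y : TensorAlgebra K V} (hx : x ∈ degPart K V n)
    (hy : y ∈ degPart K V m) : x * y ∈ degPart K V (n + m) := by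
  rw [degPart, pow_add]
  exact Submodule.mul_mem_mul hx hy

@[simp]
theorem degProj_zero_one : degProj K V 0 1 = 1 := degProj_of_mem one_mem_degPart

@[simp]
theorem degProj_succ_one (n : ℕ) : degProj K V (n + 1) 1 = 0 :=
  degProj_of_mem_ne (Nat.succ_ne_zero n).symm one_mem_degPart

@[simp]
theorem degProj_zero_ι_mul (v : V) (x : TensorAlgebra K V) : degProj K V 0 (ι K v * x) = 0 :=
  DirectSum.coe_decompose_mul_of_left_mem_of_not_le
    (fun n : ℕ => LinearMap.range (ι K : V →ₗ[K] TensorAlgebra K V) ^ n)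
    (ι_mem_degPart v) (by simp)

@[simp]
theorem degProj_succ_ι_mul (n : ℕ) (v : V) (x : TensorAlgebra K V) :
    degProj K V (n + 1) (ι K v * x) = ι K v * degProj K V n x := by
  rw [add_comm]
  exact DirectSum.coe_decompose_mul_add_of_left_mem
    (fun n : ℕ => LinearMap.range (ι K : V →ₗ[K] TensorAlgebra K V) ^ n) (ι_mem_degPart v)

end TensorAlgebra

open TensorAlgebra TensorProduct

variable {K : Type*} [Field K] {V : Type*} [AddCommGroup V] [Module K V]

variable (K V) in
/-- A braiding of `V`: a linear endomorphism `c` of `V ⊗ V` (not assumed invertible) satisfying the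
quantum Yang-Baxter equation `c₁ c₂ c₁ = c₂ c₁ c₂` on `V ⊗ V ⊗ V`, where `c₁ = c ⊗ V` and
`c₂ = V ⊗ c`. -/
structure Braiding where
  /-- the underlying linear map -/
  c : V ⊗[K] V →ₗ[K] V ⊗[K] V
  yang_baxter :
    let c₁ : (V ⊗[K] V) ⊗[K] V →ₗ[K] (V ⊗[K] V) ⊗[K] V := c.rTensor V
    let c₂ : (V ⊗[K] V) ⊗[K] V →ₗ[K] (V ⊗[K] V) ⊗[K] V :=
      (TensorProduct.assoc K V V V).symm.toLinearMap ∘ₗ c.lTensor V ∘ₗ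
        (TensorProduct.assoc K V V V).toLinearMap
    c₁ ∘ₗ c₂ ∘ₗ c₁ = c₂ ∘ₗ c₁ ∘ₗ c₂

namespace Braiding

variable (c : Braiding K V)
variable {X Y : Type*} [AddCommGroup X] [Module K X] [AddCommGroup Y] [Module K Y]

variable (X) in
/-- `c` acting on the first two factors of `V ⊗ (V ⊗ X)`. -/
noncomputable def head : V ⊗[K] (V ⊗[K] X) →ₗ[K] V ⊗[K] (V ⊗[K] X) :=
  (TensorProduct.assoc K V V X).toLinearMap ∘ₗ c.c.rTensor X ∘ₗ
    (TensorProduct.assoc K V V X).symm.toLinearMap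

theorem head_tmul (v u : V) (x : X) :
    c.head X (v ⊗ₜ (u ⊗ₜ x)) = TensorProduct.assoc K V V X (c.c (v ⊗ₜ u) ⊗ₜ x) := by
  simp [head]

theorem head_naturality (f : X →ₗ[K] Y) (z : V ⊗[K] (V ⊗[K] X)) :
    (f.lTensor V).lTensor V (c.head X z) = c.head Y ((f.lTensor V).lTensor V z) := by
  have h : ∀ (t : V ⊗[K] V) (x : X), (f.lTensor V).lTensor V (TensorProduct.assoc K V V X (t ⊗ₜ x))
      = TensorProduct.assoc K V V Y (t ⊗ₜ f x) := by
    intro t x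
    induction t with
    | zero => simp
    | add a b ha hb => simp only [add_tmul, map_add, ha, hb]
    | tmul a b => simp
  induction z with
  | zero => simp
  | add a b ha hb => simp only [map_add, ha, hb]
  | tmul v z =>
    induction z with
    | zero => simp
    | add a b ha hb => simp only [tmul_add, map_add, ha, hb]
    | tmul u x => simp [head_tmul, h]

theorem lTensor_assoc_congr {Y : Type*} [AddCommMonoid Y] [Module K Y] {f : V ⊗[K] X →ₗ[K] Y} {g : V →ₗ[K] Y} {x : X}
    (h : ∀ v, f (v ⊗ₜ x) = g v) (t : V ⊗[K] V) :
    f.lTensor V (TensorProduct.assoc K V V X (t ⊗ₜ x)) = g.lTensor V t := by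
  induction t with
  | zero => simp
  | add a b ha hb => simp only [add_tmul, map_add, ha, hb]
  | tmul a b => simp [h]

theorem lTensor_head_congr {Y : Type*} [AddCommMonoid Y] [Module K Y] {f g : V ⊗[K] X →ₗ[K] Y} {x : X}
    (h : ∀ v, f (v ⊗ₜ x) = g (v ⊗ₜ x)) (v u : V) :
    f.lTensor V (c.head X (v ⊗ₜ (u ⊗ₜ x))) = g.lTensor V (c.head X (v ⊗ₜ (u ⊗ₜ x))) := by
  rw [head_tmul, lTensor_assoc_congr (g := g ∘ₗ (TensorProduct.mk K V X).flip x) (by simpa using h),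
    lTensor_assoc_congr (g := g ∘ₗ (TensorProduct.mk K V X).flip x) (by simp)]

theorem head_yang_baxter (z : V ⊗[K] (V ⊗[K] (V ⊗[K] X))) :
    c.head _ ((c.head X).lTensor V (c.head _ z)) =
      (c.head X).lTensor V (c.head _ ((c.head X).lTensor V z)) := by
  let r (x : X) : (V ⊗[K] V) ⊗[K] V →ₗ[K] V ⊗[K] (V ⊗[K] (V ⊗[K] X)) :=
    (((TensorProduct.mk K V X).flip x).lTensor V).lTensor V ∘ₗ
      (TensorProduct.assoc K V V V).toLinearMap
  have h₁ : ∀ x z, c.head _ (r x z) = r x (c.c.rTensor V z) := by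
    intro x z
    simp only [r, LinearMap.comp_apply, LinearEquiv.coe_coe]
    rw [← head_naturality]
    simp [head]
  have h₂ : ∀ x z, (c.head X).lTensor V (r x z) = r x ((TensorProduct.assoc K V V V).symm
      (c.c.lTensor V (TensorProduct.assoc K V V V z))) := by
    intro x z
    have h : c.head X ∘ₗ ((TensorProduct.mk K V X).flip x).lTensor V =
        ((TensorProduct.mk K V X).flip x).lTensor V ∘ₗ c.c := by
      ext v u
      simp only [AlgebraTensorModule.curry_apply, curry_apply, LinearMap.coe_restrictScalars,
        LinearMap.comp_apply, LinearMap.lTensor_tmul, LinearMap.flip_apply, mk_apply, head_tmul]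
      generalize c.c (v ⊗ₜ u) = t
      induction t with
      | zero => simp
      | add a b ha hb => simp only [add_tmul, map_add, ha, hb]
      | tmul a b => simp
    simp only [r, LinearMap.comp_apply, LinearEquiv.coe_coe, LinearEquiv.apply_symm_apply]
    rw [← LinearMap.comp_apply, ← LinearMap.lTensor_comp, h, LinearMap.lTensor_comp,
      LinearMap.comp_apply]
  have key : ∀ x z, c.head _ ((c.head X).lTensor V (c.head _ (r x z))) =
      (c.head X).lTensor V (c.head _ ((c.head X).lTensor V (r x z))) := by
    intro x z
    simp only [h₁, h₂]
    exact congrArg (r x) (LinearMap.congr_fun c.yang_baxter z)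
  induction z with
  | zero => simp
  | add a b ha hb => simp only [map_add, ha, hb]
  | tmul v z =>
    induction z with
    | zero => simp
    | add a b ha hb => simp only [tmul_add, map_add, ha, hb]
    | tmul u z =>
      induction z with
      | zero => simp
      | add a b ha hb => simp only [tmul_add, map_add, ha, hb]
      | tmul w x => simpa [r] using key x ((v ⊗ₜ u) ⊗ₜ w)

/-! ### The braiding of the tensor algebra -/

/-- The component `T(V) ⊗ V → V ⊗ T(V)` of the braiding of the tensor algebra `T(V, c)`. It is
determined by `1 ⊗ w ↦ w ⊗ 1` and the compatibility of the braiding with the product: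
on `V ⊗ T(V) ⊗ V`, braiding `v * x` with `w` is first braiding `x` with `w`, then applying `c` to
`v` and the outcome. -/
noncomputable def braidTV : TensorAlgebra K V ⊗[K] V →ₗ[K] V ⊗[K] TensorAlgebra K V :=
  TensorProduct.lift (LinearMap.compl₂
    (TensorAlgebra.lift K
      (TensorProduct.curry ((lmul K V).lTensor V ∘ₗ c.head _))).toLinearMap
    ((TensorProduct.mk K V (TensorAlgebra K V)).flip 1))

@[simp]
theorem braidTV_one (w : V) : c.braidTV (1 ⊗ₜ w) = w ⊗ₜ 1 := by
  simp [braidTV]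

theorem braidTV_ι_mul (v : V) (x : TensorAlgebra K V) (w : V) :
    c.braidTV ((ι K v * x) ⊗ₜ w) =
      (lmul K V).lTensor V (c.head _ (v ⊗ₜ c.braidTV (x ⊗ₜ w))) := by
  simp [braidTV]

/-- One step of the recursion for `braidVT`. -/
noncomputable def braidVTStep :
    V →ₗ[K] Module.End K (V →ₗ[K] TensorAlgebra K V ⊗[K] V) :=
  LinearMap.mk₂ K (fun u g => lmulTensor K V V ∘ₗ g.lTensor V ∘ₗ c.c ∘ₗ
      (TensorProduct.mk K V V).flip u)
    (fun _ _ _ => by ext; simp [tmul_add]) (fun _ _ _ => by ext; simp)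
    (fun _ _ _ => by ext; simp [LinearMap.lTensor_add]) (fun _ _ _ => by ext; simp)

/-- The component `V ⊗ T(V) → T(V) ⊗ V` of the braiding of the tensor algebra `T(V, c)`. It is
determined by `v ⊗ 1 ↦ 1 ⊗ v` and the compatibility of the braiding with the product:
on `V ⊗ V ⊗ T(V)`, braiding `v` with `u * x` is first applying `c` to `v ⊗ u`, then braiding the
outcome with `x`. -/
noncomputable def braidVT : V ⊗[K] TensorAlgebra K V →ₗ[K] TensorAlgebra K V ⊗[K] V :=
  TensorProduct.lift
    (leftRec c.braidVTStep (TensorProduct.mk K (TensorAlgebra K V) V 1)).flip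

@[simp]
theorem braidVT_one (v : V) : c.braidVT (v ⊗ₜ 1) = 1 ⊗ₜ v := by
  simp [braidVT]

theorem braidVT_ι_mul (v u : V) (x : TensorAlgebra K V) :
    c.braidVT (v ⊗ₜ (ι K u * x)) =
      lmulTensor K V V (c.braidVT.lTensor V (c.head _ (v ⊗ₜ (u ⊗ₜ x)))) := by
  rw [head_tmul, lTensor_assoc_congr
    (g := leftRec c.braidVTStep (TensorProduct.mk K (TensorAlgebra K V) V 1) x)
    (fun w => by simp [braidVT])]
  simp [braidVT, braidVTStep]

/-! ### The braided comultiplication of the tensor algebra -/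

/-- Left multiplication by `1 ⊗ v` in the braided tensor product algebra `T(V) ⊗ T(V)`:
`v ⊗ (x ⊗ y) ↦ (1 ⊗ v)(x ⊗ y)`, where `v` is moved past `x` by the braiding. -/
noncomputable def lmulSnd : V ⊗[K] (TensorAlgebra K V ⊗[K] TensorAlgebra K V) →ₗ[K]
    TensorAlgebra K V ⊗[K] TensorAlgebra K V :=
  (lmul K V).lTensor _ ∘ₗ (TensorProduct.assoc K _ V _).toLinearMap ∘ₗ
    c.braidVT.rTensor _ ∘ₗ (TensorProduct.assoc K V _ _).symm.toLinearMap

/-- The comultiplication `Δ` of the braided bialgebra `T(V, c)`: the algebra homomorphism to the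
braided tensor product algebra `T(V) ⊗ T(V)` with `v ↦ v ⊗ 1 + 1 ⊗ v` for `v ∈ V`, given through
`Δ 1 = 1 ⊗ 1` and `Δ (v * x) = (v ⊗ 1 + 1 ⊗ v) Δ x`. -/
noncomputable def comul :
    TensorAlgebra K V →ₗ[K] TensorAlgebra K V ⊗[K] TensorAlgebra K V :=
  leftRec (TensorProduct.curry (lmulTensor K V (TensorAlgebra K V) + c.lmulSnd)) (1 ⊗ₜ 1)

@[simp]
theorem comul_one : c.comul 1 = 1 ⊗ₜ 1 := by simp [comul]

theorem comul_ι_mul (v : V) (x : TensorAlgebra K V) :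
    c.comul (ι K v * x) = lmulTensor K V _ (v ⊗ₜ c.comul x) + c.lmulSnd (v ⊗ₜ c.comul x) := by
  simp [comul]

/-- The homogeneous component `Δ^{p,q} = (π^p ⊗ π^q) Δ` of the comultiplication of `T(V, c)`, where
`π^n` is the projection onto the degree `n` component. -/
noncomputable def comulPart (p q : ℕ) :
    TensorAlgebra K V →ₗ[K] TensorAlgebra K V ⊗[K] TensorAlgebra K V :=
  TensorProduct.map (degProj K V p) (degProj K V q) ∘ₗ c.comul

/-! ### Primitive elements -/

/-- `E_n(V, c)`: zero for `n = 0, 1`, and for `n ≥ 2` the intersection of the kernels of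
`Δ^{p,q}` on `V^{⊗ n}`, over all `p, q ≥ 1` with `p + q = n`. -/
noncomputable def En (n : ℕ) : Submodule K (TensorAlgebra K V) :=
  if n ≤ 1 then ⊥ else
    degPart K V n ⊓ ⨅ (p : ℕ) (q : ℕ) (_ : 1 ≤ p) (_ : 1 ≤ q) (_ : p + q = n),
      LinearMap.ker (c.comulPart p q)

/-- `E(V, c) = ⨁ E_n(V, c)`, the space of primitive elements of degree at least two of `T(V, c)`. -/
noncomputable def E : Submodule K (TensorAlgebra K V) := ⨆ n, c.En n


/-! ### Compatibility of the braiding with itself, the grading and the comultiplication -/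

theorem lTensor_comp_apply {Z W X Y : Type*} [AddCommMonoid Z] [Module K Z] [AddCommMonoid W]
    [Module K W] [AddCommMonoid X] [Module K X] [AddCommMonoid Y] [Module K Y]
    (g : X →ₗ[K] Y) (f : W →ₗ[K] X) (z : Z ⊗[K] W) :
    g.lTensor Z (f.lTensor Z z) = (g ∘ₗ f).lTensor Z z := by
  rw [LinearMap.lTensor_comp, LinearMap.comp_apply]

/-- `x ↦ c_{T(V), V} (x ⊗ w)`. -/
noncomputable def braidWith (w : V) : TensorAlgebra K V →ₗ[K] V ⊗[K] TensorAlgebra K V :=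
  c.braidTV ∘ₗ (TensorProduct.mk K (TensorAlgebra K V) V).flip w

theorem braidWith_apply (w : V) (x : TensorAlgebra K V) :
    c.braidWith w x = c.braidTV (x ⊗ₜ w) := rfl

theorem braidWith_one (w : V) : c.braidWith w 1 = w ⊗ₜ 1 := c.braidTV_one w

theorem braidWith_ι_mul (w v : V) (x : TensorAlgebra K V) :
    c.braidWith w (ι K v * x) = (lmul K V).lTensor V (c.head _ (v ⊗ₜ c.braidWith w x)) :=
  c.braidTV_ι_mul v x w

theorem braidWith_comp_lmul (w : V) :
    c.braidWith w ∘ₗ lmul K V =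
      (lmul K V).lTensor V ∘ₗ c.head _ ∘ₗ (c.braidWith w).lTensor V := by
  ext v x
  simp [braidWith_ι_mul]

theorem braidVT_comp_lmul :
    c.braidVT ∘ₗ (lmul K V).lTensor V =
      lmulTensor K V V ∘ₗ c.braidVT.lTensor V ∘ₗ c.head _ := by
  ext v u x
  simp [braidVT_ι_mul]

theorem head_comp_lTensor (f : X →ₗ[K] Y) :
    (f.lTensor V).lTensor V ∘ₗ c.head X = c.head Y ∘ₗ (f.lTensor V).lTensor V :=
  LinearMap.ext (c.head_naturality f)

theorem lTensor_head_apply_congr {Y : Type*} [AddCommMonoid Y] [Module K Y]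
    {f : V ⊗[K] X →ₗ[K] Y} {X' : Type*} [AddCommGroup X'] [Module K X']
    {g : V ⊗[K] X' →ₗ[K] Y} {x : X} {x' : X'}
    (h : ∀ v, f (v ⊗ₜ x) = g (v ⊗ₜ x')) (v u : V) :
    f.lTensor V (c.head X (v ⊗ₜ (u ⊗ₜ x))) = g.lTensor V (c.head X' (v ⊗ₜ (u ⊗ₜ x'))) := by
  rw [head_tmul, head_tmul,
    lTensor_assoc_congr (g := g ∘ₗ (TensorProduct.mk K V X').flip x') (by simpa using h),
    lTensor_assoc_congr (g := g ∘ₗ (TensorProduct.mk K V X').flip x') (by simp)]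

/-- `x ⊗ v ↦ c_{T(V), V} (x ⊗ w') ⊗ v'`, where `c (v ⊗ w) = w' ⊗ v'`. -/
noncomputable def braidPair (w : V) : TensorAlgebra K V ⊗[K] V →ₗ[K]
    V ⊗[K] (TensorAlgebra K V ⊗[K] V) :=
  (TensorProduct.assoc K V _ V).toLinearMap ∘ₗ c.braidTV.rTensor V ∘ₗ
    (TensorProduct.assoc K _ V V).symm.toLinearMap ∘ₗ
    (c.c ∘ₗ (TensorProduct.mk K V V).flip w).lTensor _

theorem braidPair_tmul (w : V) (x : TensorAlgebra K V) (v : V) :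
    c.braidPair w (x ⊗ₜ v) = TensorProduct.assoc K V _ V (c.braidTV.rTensor V
      ((TensorProduct.assoc K _ V V).symm (x ⊗ₜ c.c (v ⊗ₜ w)))) := by
  simp [braidPair]

theorem braidPair_comp_lmulTensor (w : V) :
    c.braidPair w ∘ₗ lmulTensor K V V =
      (lmulTensor K V V).lTensor V ∘ₗ c.head _ ∘ₗ (c.braidPair w).lTensor V := by
  ext u x v
  simp only [AlgebraTensorModule.curry_apply, curry_apply, LinearMap.coe_restrictScalars,
    LinearMap.comp_apply, LinearMap.lTensor_tmul, lmulTensor_tmul, braidPair_tmul]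
  generalize c.c (v ⊗ₜ w) = t
  induction t with
  | zero => simp
  | add a b ha hb => simp only [tmul_add, map_add, ha, hb]
  | tmul a b =>
    simp only [assoc_symm_tmul, LinearMap.rTensor_tmul, braidTV_ι_mul]
    generalize c.braidTV (x ⊗ₜ a) = s
    induction s with
    | zero => simp
    | add a b ha hb => simp only [tmul_add, add_tmul, map_add, ha, hb]
    | tmul p q =>
      simp only [assoc_tmul, head_tmul]
      generalize c.c (u ⊗ₜ p) = r
      induction r with
      | zero => simp
      | add a b ha hb => simp only [add_tmul, map_add, ha, hb]
      | tmul m n => simp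

theorem braid_VTV (v : V) (x : TensorAlgebra K V) (w : V) :
    c.braidVT.lTensor V (c.head _ (v ⊗ₜ c.braidWith w x)) =
      c.braidPair w (c.braidVT (v ⊗ₜ x)) := by
  induction x using left_induction generalizing v with
  | one =>
    rw [braidWith_one, head_tmul, braidVT_one, braidPair_tmul]
    generalize c.c (v ⊗ₜ w) = t
    induction t with
    | zero => simp
    | add a b ha hb => simp only [tmul_add, add_tmul, map_add, ha, hb]
    | tmul a b => simp
  | add x y hx hy => simp only [map_add, tmul_add, hx, hy]
  | smul k x hx => simp only [map_smul, tmul_smul, hx]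
  | ι_mul u x ih =>
    have e₁ : c.head _ (v ⊗ₜ (lmul K V).lTensor V (c.head _ (u ⊗ₜ c.braidWith w x))) =
        ((lmul K V).lTensor V).lTensor V (c.head _ ((c.head _).lTensor V
          (v ⊗ₜ (u ⊗ₜ c.braidWith w x)))) := by
      rw [head_naturality]; simp
    rw [braidWith_ι_mul, e₁, braidVT_ι_mul, lTensor_comp_apply, braidVT_comp_lmul,
      ← LinearMap.comp_apply (c.braidPair w), braidPair_comp_lmulTensor,
      LinearMap.lTensor_comp, LinearMap.lTensor_comp, LinearMap.comp_apply, LinearMap.comp_apply,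
      ← head_yang_baxter, head_naturality, LinearMap.comp_apply, LinearMap.comp_apply,
      lTensor_comp_apply, lTensor_comp_apply]
    congr 2
    exact c.lTensor_head_apply_congr (by simpa using ih) v u

/-- `v ⊗ (x ⊗ u) ↦ c_{V, T(V)} (v ⊗ x) ⊗ u`. -/
noncomputable def braidFst (X : Type*) [AddCommGroup X] [Module K X] :
    V ⊗[K] (TensorAlgebra K V ⊗[K] X) →ₗ[K] TensorAlgebra K V ⊗[K] (V ⊗[K] X) :=
  (TensorProduct.assoc K _ V X).toLinearMap ∘ₗ c.braidVT.rTensor X ∘ₗ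
    (TensorProduct.assoc K V _ X).symm.toLinearMap

theorem braidFst_tmul (v : V) (x : TensorAlgebra K V) (u : X) :
    c.braidFst X (v ⊗ₜ (x ⊗ₜ u)) = TensorProduct.assoc K _ V X (c.braidVT (v ⊗ₜ x) ⊗ₜ u) := by
  simp [braidFst]

theorem braidFst_comp_lmulTensor :
    c.braidFst X ∘ₗ (lmulTensor K V X).lTensor V =
      lmulTensor K V _ ∘ₗ (c.braidFst X).lTensor V ∘ₗ c.head _ := by
  ext v u x w
  simp only [AlgebraTensorModule.curry_apply, curry_apply, LinearMap.coe_restrictScalars,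
    LinearMap.comp_apply, LinearMap.lTensor_tmul, lmulTensor_tmul, braidFst_tmul, braidVT_ι_mul,
    head_tmul]
  generalize c.c (v ⊗ₜ u) = t
  induction t with
  | zero => simp
  | add a b ha hb => simp only [add_tmul, map_add, ha, hb]
  | tmul a b =>
    simp only [assoc_tmul, LinearMap.lTensor_tmul, braidFst_tmul]
    generalize c.braidVT (b ⊗ₜ x) = s
    induction s with
    | zero => simp
    | add a b ha hb => simp only [tmul_add, add_tmul, map_add, ha, hb]
    | tmul p q => simp

/-- The braiding `V ⊗ (V ⊗ T(V)) → T(V) ⊗ (V ⊗ V)`. -/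
noncomputable def braidVVT :
    V ⊗[K] (V ⊗[K] TensorAlgebra K V) →ₗ[K] TensorAlgebra K V ⊗[K] (V ⊗[K] V) :=
  c.braidFst V ∘ₗ c.braidVT.lTensor V

theorem braidVVT_comp_lmul :
    c.braidVVT ∘ₗ ((lmul K V).lTensor V).lTensor V =
      lmulTensor K V _ ∘ₗ c.braidVVT.lTensor V ∘ₗ c.head _ ∘ₗ (c.head _).lTensor V := by
  rw [braidVVT, LinearMap.comp_assoc, ← LinearMap.lTensor_comp, braidVT_comp_lmul,
    LinearMap.lTensor_comp, ← LinearMap.comp_assoc, braidFst_comp_lmulTensor,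
    LinearMap.lTensor_comp, LinearMap.lTensor_comp]
  simp only [LinearMap.comp_assoc]
  rw [← LinearMap.comp_assoc _ _ (c.head _), ← head_comp_lTensor]
  simp only [LinearMap.comp_assoc]

theorem lTensor_comp_lmulTensor (f : X →ₗ[K] Y) (z : V ⊗[K] (TensorAlgebra K V ⊗[K] X)) :
    f.lTensor _ (lmulTensor K V X z) = lmulTensor K V Y ((f.lTensor _).lTensor V z) := by
  rw [← LinearMap.comp_apply, ← LinearMap.comp_apply (lmulTensor K V Y)]
  congr 1
  ext v x w
  simp

theorem braid_VVT (v u : V) (x : TensorAlgebra K V) :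
    c.c.lTensor _ (c.braidVVT (v ⊗ₜ (u ⊗ₜ x))) = c.braidVVT (c.head _ (v ⊗ₜ (u ⊗ₜ x))) := by
  induction x using left_induction generalizing v u with
  | one =>
    have h : ∀ t : V ⊗[K] V, c.braidVVT (TensorProduct.assoc K V V _ (t ⊗ₜ 1)) = 1 ⊗ₜ t := by
      intro t
      induction t with
      | zero => simp
      | add a b ha hb => simp only [tmul_add, add_tmul, map_add, ha, hb]
      | tmul a b => simp [braidVVT, braidFst_tmul]
    have h' := h (v ⊗ₜ u)
    rw [assoc_tmul] at h'
    rw [h', head_tmul, h]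
    simp
  | add x y hx hy => simp only [map_add, tmul_add, hx, hy]
  | smul k x hx => simp only [map_smul, tmul_smul, hx]
  | ι_mul w x ih =>
    let f : K →ₗ[K] TensorAlgebra K V := LinearMap.toSpanSingleton K _ x
    have ih' : (c.c.lTensor _ ∘ₗ c.braidVVT) ∘ₗ (f.lTensor V).lTensor V =
        (c.braidVVT ∘ₗ c.head _) ∘ₗ (f.lTensor V).lTensor V := by
      ext v u
      simpa [f] using ih v u
    have e₁ : v ⊗ₜ[K] (u ⊗ₜ[K] (ι K w * x)) = ((lmul K V).lTensor V).lTensor V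
        (((f.lTensor V).lTensor V).lTensor V (v ⊗ₜ (u ⊗ₜ (w ⊗ₜ 1)))) := by
      simp [f]
    generalize v ⊗ₜ[K] (u ⊗ₜ[K] (w ⊗ₜ[K] (1 : K))) = z at e₁
    have e₂ := fun y => LinearMap.congr_fun c.braidVVT_comp_lmul y
    simp only [LinearMap.comp_apply] at e₂
    have e₃ : ∀ y, (c.head _).lTensor V (((f.lTensor V).lTensor V).lTensor V y) =
        ((f.lTensor V).lTensor V).lTensor V ((c.head _).lTensor V y) := by
      intro y
      rw [lTensor_comp_apply, lTensor_comp_apply, head_comp_lTensor]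
    rw [e₁, ← head_naturality, e₂, e₂, lTensor_comp_lmulTensor, head_yang_baxter, e₃,
      ← head_naturality, lTensor_comp_apply, lTensor_comp_apply, lTensor_comp_apply,
      lTensor_comp_apply, ih']

theorem degProj_comp_lmul_zero : degProj K V 0 ∘ₗ lmul K V = 0 := by
  ext v x; simp

theorem degProj_comp_lmul_succ (n : ℕ) :
    degProj K V (n + 1) ∘ₗ lmul K V = lmul K V ∘ₗ (degProj K V n).lTensor V := by
  ext v x; simp

theorem braidWith_degProj (w : V) (n : ℕ) (x : TensorAlgebra K V) :
    (degProj K V n).lTensor V (c.braidWith w x) = c.braidWith w (degProj K V n x) := by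
  induction x using left_induction generalizing n with
  | one => cases n <;> simp [braidWith_one]
  | add x y hx hy => simp only [map_add, hx, hy]
  | smul k x hx => simp only [map_smul, hx]
  | ι_mul u x ih =>
    rw [braidWith_ι_mul, lTensor_comp_apply]
    cases n with
    | zero => simp [degProj_comp_lmul_zero]
    | succ n =>
      rw [degProj_comp_lmul_succ, LinearMap.lTensor_comp, LinearMap.comp_apply, head_naturality,
        LinearMap.lTensor_tmul, ih, degProj_succ_ι_mul, braidWith_ι_mul]

theorem rTensor_degProj_lmulTensor (n : ℕ) (z : V ⊗[K] (TensorAlgebra K V ⊗[K] X)) :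
    (degProj K V (n + 1)).rTensor X (lmulTensor K V X z) =
      lmulTensor K V X (((degProj K V n).rTensor X).lTensor V z) := by
  rw [← LinearMap.comp_apply, ← LinearMap.comp_apply (lmulTensor K V X)]
  congr 1
  ext v x w
  simp

theorem rTensor_degProj_zero_lmulTensor (z : V ⊗[K] (TensorAlgebra K V ⊗[K] X)) :
    (degProj K V 0).rTensor X (lmulTensor K V X z) = 0 := by
  have : (degProj K V 0).rTensor X ∘ₗ lmulTensor K V X = 0 := by ext v x w; simp
  exact LinearMap.congr_fun this z

theorem braidVT_degProj (v : V) (n : ℕ) (x : TensorAlgebra K V) :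
    (degProj K V n).rTensor V (c.braidVT (v ⊗ₜ x)) = c.braidVT (v ⊗ₜ degProj K V n x) := by
  induction x using left_induction generalizing n v with
  | one => cases n <;> simp
  | add x y hx hy => simp only [map_add, tmul_add, hx, hy]
  | smul k x hx => simp only [map_smul, tmul_smul, hx]
  | ι_mul u x ih =>
    rw [braidVT_ι_mul]
    cases n with
    | zero => simp [rTensor_degProj_zero_lmulTensor]
    | succ n =>
      rw [rTensor_degProj_lmulTensor, lTensor_comp_apply, degProj_succ_ι_mul, braidVT_ι_mul]
      congr 1
      exact c.lTensor_head_apply_congr (by simpa using fun v => ih v n) v u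

/-- The braiding `T(V) ⊗ T(V) → V ⊗ (T(V) ⊗ T(V))` with `w`. -/
noncomputable def braidWith₂ (w : V) : TensorAlgebra K V ⊗[K] TensorAlgebra K V →ₗ[K]
    V ⊗[K] (TensorAlgebra K V ⊗[K] TensorAlgebra K V) :=
  (TensorProduct.assoc K V _ _).toLinearMap ∘ₗ c.braidTV.rTensor _ ∘ₗ
    (TensorProduct.assoc K _ V _).symm.toLinearMap ∘ₗ (c.braidWith w).lTensor _

theorem braidWith₂_tmul (w : V) (x y : TensorAlgebra K V) :
    c.braidWith₂ w (x ⊗ₜ y) = TensorProduct.assoc K V _ _ (c.braidTV.rTensor _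
      ((TensorProduct.assoc K _ V _).symm (x ⊗ₜ c.braidWith w y))) := by
  simp [braidWith₂]

theorem braidWith₂_comp_lmulTensor (w : V) :
    c.braidWith₂ w ∘ₗ lmulTensor K V _ =
      (lmulTensor K V _).lTensor V ∘ₗ c.head _ ∘ₗ (c.braidWith₂ w).lTensor V := by
  ext u x y
  simp only [AlgebraTensorModule.curry_apply, curry_apply, LinearMap.coe_restrictScalars,
    LinearMap.comp_apply, LinearMap.lTensor_tmul, lmulTensor_tmul, braidWith₂_tmul]
  generalize c.braidWith w y = t
  induction t with
  | zero => simp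
  | add a b ha hb => simp only [tmul_add, map_add, ha, hb]
  | tmul a b =>
    simp only [assoc_symm_tmul, LinearMap.rTensor_tmul, braidTV_ι_mul]
    generalize c.braidTV (x ⊗ₜ a) = s
    induction s with
    | zero => simp
    | add a b ha hb => simp only [tmul_add, add_tmul, map_add, ha, hb]
    | tmul p q =>
      simp only [assoc_tmul, head_tmul]
      generalize c.c (u ⊗ₜ p) = r
      induction r with
      | zero => simp
      | add a b ha hb => simp only [add_tmul, map_add, ha, hb]
      | tmul m n => simp

theorem braidWith₂_comp_lmulSnd (w : V) :
    c.braidWith₂ w ∘ₗ c.lmulSnd =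
      c.lmulSnd.lTensor V ∘ₗ c.head _ ∘ₗ (c.braidWith₂ w).lTensor V := by
  -- both sides on `u ⊗ (x ⊗ y)`, as functions of the outcome of braiding `y` with `w`
  let L : TensorAlgebra K V ⊗[K] (V ⊗[K] TensorAlgebra K V) →ₗ[K]
      V ⊗[K] (TensorAlgebra K V ⊗[K] TensorAlgebra K V) :=
    (TensorProduct.assoc K V _ _).toLinearMap ∘ₗ c.braidTV.rTensor _ ∘ₗ
      (TensorProduct.assoc K _ V _).symm.toLinearMap
  have hL : ∀ x a y, L (x ⊗ₜ (a ⊗ₜ y)) =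
      TensorProduct.assoc K V _ _ (c.braidWith a x ⊗ₜ y) := by
    intro x a y; simp [L, braidWith_apply]
  have hw : ∀ x y, c.braidWith₂ w (x ⊗ₜ y) = L (x ⊗ₜ c.braidWith w y) := by
    intro x y; simp [L, braidWith₂_tmul]
  have hs : ∀ u x y, c.lmulSnd (u ⊗ₜ (x ⊗ₜ y)) = (lmul K V).lTensor _
      (TensorProduct.assoc K _ V _ (c.braidVT (u ⊗ₜ x) ⊗ₜ y)) := by
    intro u x y; simp [lmulSnd]
  -- the appended factor `y` is a spectator
  let app (y : TensorAlgebra K V) : TensorAlgebra K V ⊗[K] V →ₗ[K]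
      TensorAlgebra K V ⊗[K] TensorAlgebra K V :=
    (lmul K V ∘ₗ (TensorProduct.mk K V _).flip y).lTensor _
  have hs' : ∀ u x y, c.lmulSnd (u ⊗ₜ (x ⊗ₜ y)) = app y (c.braidVT (u ⊗ₜ x)) := by
    intro u x y
    rw [hs]
    generalize c.braidVT (u ⊗ₜ x) = t
    induction t with
    | zero => simp
    | add a b ha hb => simp only [add_tmul, map_add, ha, hb]
    | tmul a b => simp [app]
  have key : ∀ (a : V) (y : TensorAlgebra K V) (t : TensorAlgebra K V ⊗[K] V),
      (app y).lTensor V (c.braidPair a t) =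
        L ((((lmul K V).lTensor V ∘ₗ c.head _) ∘ₗ
          (TensorProduct.mk K V (V ⊗[K] TensorAlgebra K V)).flip (a ⊗ₜ y)).lTensor _ t) := by
    intro a y t
    induction t with
    | zero => simp
    | add a b ha hb => simp only [map_add, ha, hb]
    | tmul x v =>
      simp only [LinearMap.lTensor_tmul, LinearMap.comp_apply, LinearMap.flip_apply, mk_apply,
        head_tmul, braidPair_tmul]
      generalize c.c (v ⊗ₜ a) = s
      induction s with
      | zero => simp
      | add a b ha hb => simp only [add_tmul, tmul_add, map_add, ha, hb]
      | tmul p q =>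
        simp only [assoc_tmul, assoc_symm_tmul, LinearMap.lTensor_tmul, LinearMap.rTensor_tmul,
          lmul_tmul, hL, braidWith_apply]
        generalize c.braidTV (x ⊗ₜ p) = r
        induction r with
        | zero => simp
        | add a b ha hb => simp only [add_tmul, map_add, ha, hb]
        | tmul m n => simp [app]
  ext u x y
  simp only [AlgebraTensorModule.curry_apply, curry_apply, LinearMap.coe_restrictScalars,
    LinearMap.comp_apply, LinearMap.lTensor_tmul, hw]
  have h₁ : c.braidWith₂ w (c.lmulSnd (u ⊗ₜ (x ⊗ₜ y))) =
      L ((((lmul K V).lTensor V ∘ₗ c.head _) ∘ₗ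
          (TensorProduct.mk K V (V ⊗[K] TensorAlgebra K V)).flip (c.braidWith w y)).lTensor _
            (c.braidVT (u ⊗ₜ x))) := by
    rw [hs']
    generalize c.braidVT (u ⊗ₜ x) = t
    induction t with
    | zero => simp
    | add a b ha hb => simp only [map_add, ha, hb]
    | tmul a b => simp [app, hw, braidWith_ι_mul]
  rw [h₁]
  generalize c.braidWith w y = b
  induction b with
  | zero => simp
  | add b₁ b₂ h₁ h₂ =>
    simp only [map_add, tmul_add, ← h₁, ← h₂, LinearMap.comp_add, LinearMap.lTensor_add,
      LinearMap.add_apply]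
  | tmul a y =>
    rw [← key, ← braid_VTV, hL]
    generalize c.braidWith a x = t
    induction t with
    | zero => simp
    | add a b ha hb => simp only [map_add, tmul_add, add_tmul, ha, hb]
    | tmul p q =>
      simp only [assoc_tmul, head_tmul]
      generalize c.c (u ⊗ₜ p) = r
      induction r with
      | zero => simp
      | add a b ha hb => simp only [map_add, add_tmul, ha, hb]
      | tmul m n => simp [hs']

theorem comul_comp_lmul :
    c.comul ∘ₗ lmul K V = (lmulTensor K V _ + c.lmulSnd) ∘ₗ c.comul.lTensor V := by
  ext v x
  simp [comul_ι_mul]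

theorem braidWith_comul (w : V) (x : TensorAlgebra K V) :
    c.comul.lTensor V (c.braidWith w x) = c.braidWith₂ w (c.comul x) := by
  induction x using left_induction with
  | one => simp [braidWith_one, braidWith₂_tmul]
  | add x y hx hy => simp only [map_add, hx, hy]
  | smul k x hx => simp only [map_smul, hx]
  | ι_mul u x ih =>
    have e₁ := LinearMap.congr_fun (c.braidWith₂_comp_lmulTensor w) (u ⊗ₜ c.comul x)
    have e₂ := LinearMap.congr_fun (c.braidWith₂_comp_lmulSnd w) (u ⊗ₜ c.comul x)
    simp only [LinearMap.comp_apply, LinearMap.lTensor_tmul] at e₁ e₂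
    rw [braidWith_ι_mul, lTensor_comp_apply, comul_comp_lmul, LinearMap.lTensor_comp,
      LinearMap.comp_apply, head_naturality, LinearMap.lTensor_tmul, ih, comul_ι_mul, map_add,
      e₁, e₂, LinearMap.lTensor_add, LinearMap.add_apply]

/-- The braiding `V ⊗ (T(V) ⊗ T(V)) → (T(V) ⊗ T(V)) ⊗ V`. -/
noncomputable def braidVTT : V ⊗[K] (TensorAlgebra K V ⊗[K] TensorAlgebra K V) →ₗ[K]
    (TensorAlgebra K V ⊗[K] TensorAlgebra K V) ⊗[K] V :=
  (TensorProduct.assoc K _ _ V).symm.toLinearMap ∘ₗ c.braidVT.lTensor _ ∘ₗ c.braidFst _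

/-- `v ⊗ ((x ⊗ y) ⊗ u) ↦ (v * x ⊗ y) ⊗ u` and its analogue for `lmulSnd`, for
`f = lmulTensor` and `f = lmulSnd` respectively. -/
noncomputable def extendBy (f : V ⊗[K] X →ₗ[K] X) (Y : Type*) [AddCommGroup Y] [Module K Y] :
    V ⊗[K] (X ⊗[K] Y) →ₗ[K] X ⊗[K] Y :=
  f.rTensor Y ∘ₗ (TensorProduct.assoc K V X Y).symm.toLinearMap

theorem extendBy_tmul (f : V ⊗[K] X →ₗ[K] X) (v : V) (x : X) (y : Y) :
    extendBy f Y (v ⊗ₜ (x ⊗ₜ y)) = f (v ⊗ₜ x) ⊗ₜ y := by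
  simp [extendBy]

theorem braidVTT_comp_lmulTensor :
    c.braidVTT ∘ₗ (lmulTensor K V _).lTensor V =
      extendBy (lmulTensor K V _) V ∘ₗ c.braidVTT.lTensor V ∘ₗ c.head _ := by
  have h : ((TensorProduct.assoc K (TensorAlgebra K V) (TensorAlgebra K V) V).symm.toLinearMap ∘ₗ
      c.braidVT.lTensor _) ∘ₗ lmulTensor K V _ = extendBy (lmulTensor K V _) V ∘ₗ
      ((TensorProduct.assoc K (TensorAlgebra K V) (TensorAlgebra K V) V).symm.toLinearMap ∘ₗ
      c.braidVT.lTensor _).lTensor V := by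
    ext v x u y
    simp only [AlgebraTensorModule.curry_apply, curry_apply, LinearMap.coe_restrictScalars,
      LinearMap.comp_apply, LinearMap.lTensor_tmul, lmulTensor_tmul]
    generalize c.braidVT (u ⊗ₜ y) = t
    induction t with
    | zero => simp
    | add a b ha hb => simp only [map_add, tmul_add, ha, hb]
    | tmul a b => simp [extendBy_tmul]
  rw [braidVTT, ← LinearMap.comp_assoc (c.braidFst _), LinearMap.comp_assoc,
    braidFst_comp_lmulTensor, LinearMap.lTensor_comp, ← LinearMap.comp_assoc, h]
  simp only [LinearMap.comp_assoc]

theorem braidVTT_comp_lmulSnd :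
    c.braidVTT ∘ₗ c.lmulSnd.lTensor V =
      extendBy c.lmulSnd V ∘ₗ c.braidVTT.lTensor V ∘ₗ c.head _ := by
  have hs : ∀ u x y, c.lmulSnd (u ⊗ₜ (x ⊗ₜ y)) = (lmul K V).lTensor _
      (TensorProduct.assoc K _ V _ (c.braidVT (u ⊗ₜ x) ⊗ₜ y)) := by
    intro u x y; simp [lmulSnd]
  -- what happens to `x ⊗ (v ⊗ u)` and the spectator `y`, once `u` and `v` have passed `x`
  let F (y : TensorAlgebra K V) : V ⊗[K] V →ₗ[K] TensorAlgebra K V ⊗[K] V :=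
    lmulTensor K V V ∘ₗ c.braidVT.lTensor V ∘ₗ (TensorProduct.assoc K V V _).toLinearMap ∘ₗ
      (TensorProduct.mk K (V ⊗[K] V) _).flip y
  have left : ∀ (v u : V) (x y : TensorAlgebra K V),
      c.braidVTT (v ⊗ₜ c.lmulSnd (u ⊗ₜ (x ⊗ₜ y))) =
        (TensorProduct.assoc K _ _ V).symm ((F y ∘ₗ c.c).lTensor _
          (c.braidVVT (v ⊗ₜ (u ⊗ₜ x)))) := by
    intro v u x y
    rw [hs, braidVVT, LinearMap.comp_apply, LinearMap.lTensor_tmul]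
    generalize c.braidVT (u ⊗ₜ x) = t
    induction t with
    | zero => simp
    | add a b ha hb => simp only [map_add, tmul_add, add_tmul, ha, hb]
    | tmul x u =>
      simp only [assoc_tmul, LinearMap.lTensor_tmul, lmul_tmul, braidVTT, LinearMap.comp_apply,
        braidFst_tmul, LinearEquiv.coe_coe]
      congr 1
      generalize c.braidVT (v ⊗ₜ x) = t
      induction t with
      | zero => simp
      | add a b ha hb => simp only [map_add, add_tmul, ha, hb]
      | tmul x v => simp [F, braidVT_ι_mul, head_tmul]
  have right : ∀ (x y : TensorAlgebra K V) (t : V ⊗[K] V),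
      extendBy c.lmulSnd V (c.braidVTT.lTensor V (TensorProduct.assoc K V V _ (t ⊗ₜ (x ⊗ₜ y)))) =
        (TensorProduct.assoc K _ _ V).symm ((F y).lTensor _
          (c.braidVVT (TensorProduct.assoc K V V _ (t ⊗ₜ x)))) := by
    intro x y t
    induction t with
    | zero => simp
    | add a b ha hb => simp only [map_add, add_tmul, ha, hb]
    | tmul u v =>
      simp only [assoc_tmul, LinearMap.lTensor_tmul, braidVTT, braidVVT, LinearMap.comp_apply,
        braidFst_tmul, LinearEquiv.coe_coe]
      generalize c.braidVT (v ⊗ₜ x) = t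
      induction t with
      | zero => simp
      | add a b ha hb => simp only [map_add, add_tmul, tmul_add, ha, hb]
      | tmul x v =>
        simp only [assoc_tmul, LinearMap.lTensor_tmul, braidFst_tmul]
        generalize hb : c.braidVT (v ⊗ₜ y) = s
        have hF : ∀ u, F y (u ⊗ₜ v) = lmulTensor K V V (u ⊗ₜ s) := by
          intro u; simp [F, hb]
        change _ = (TensorProduct.assoc K _ _ V).symm ((F y).lTensor _
          (TensorProduct.assoc K _ V V (c.braidVT (u ⊗ₜ x) ⊗ₜ v)))
        have : ∀ t : TensorAlgebra K V ⊗[K] V,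
            (F y).lTensor _ (TensorProduct.assoc K _ V V (t ⊗ₜ v)) =
            (lmulTensor K V V).lTensor _ (TensorProduct.assoc K _ V _ (t ⊗ₜ s)) := by
          intro t
          induction t with
          | zero => simp
          | add a b ha hb => simp only [map_add, add_tmul, ha, hb]
          | tmul a b => simp [hF]
        rw [this]
        clear this hF hb
        induction s with
        | zero => simp
        | add a b ha hb => simp only [map_add, tmul_add, ha, hb]
        | tmul y v =>
          rw [assoc_symm_tmul, extendBy_tmul, hs]
          generalize c.braidVT (u ⊗ₜ x) = t
          induction t with
          | zero => simp
          | add a b ha hb => simp only [map_add, add_tmul, ha, hb]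
          | tmul a b => simp
  ext v u x y
  simp only [AlgebraTensorModule.curry_apply, curry_apply, LinearMap.coe_restrictScalars,
    LinearMap.comp_apply, LinearMap.lTensor_tmul]
  rw [left, head_tmul, right, ← head_tmul, ← braid_VVT, lTensor_comp_apply]

theorem braidVT_comul (v : V) (x : TensorAlgebra K V) :
    c.comul.rTensor V (c.braidVT (v ⊗ₜ x)) = c.braidVTT (v ⊗ₜ c.comul x) := by
  induction x using left_induction generalizing v with
  | one => simp [braidVTT, braidFst_tmul]
  | add x y hx hy => simp only [map_add, tmul_add, hx, hy]
  | smul k x hx => simp only [map_smul, tmul_smul, hx]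
  | ι_mul u x ih =>
    have e₁ := LinearMap.congr_fun c.braidVTT_comp_lmulTensor (v ⊗ₜ (u ⊗ₜ c.comul x))
    have e₂ := LinearMap.congr_fun c.braidVTT_comp_lmulSnd (v ⊗ₜ (u ⊗ₜ c.comul x))
    simp only [LinearMap.comp_apply, LinearMap.lTensor_tmul] at e₁ e₂
    have e₃ : ∀ z, c.comul.rTensor V (lmulTensor K V V z) =
        extendBy (lmulTensor K V _) V ((c.comul.rTensor V).lTensor V z) +
        extendBy c.lmulSnd V ((c.comul.rTensor V).lTensor V z) := by
      intro z
      rw [← LinearMap.add_apply, ← LinearMap.comp_apply, ← LinearMap.comp_apply]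
      congr 1
      ext u x w
      simp [extendBy_tmul, comul_ι_mul, add_tmul]
    rw [braidVT_ι_mul, e₃, lTensor_comp_apply, comul_ι_mul, tmul_add, map_add, e₁, e₂]
    have : (c.comul.rTensor V ∘ₗ c.braidVT).lTensor V (c.head _ (v ⊗ₜ (u ⊗ₜ x))) =
        c.braidVTT.lTensor V (c.head _ (v ⊗ₜ (u ⊗ₜ c.comul x))) :=
      c.lTensor_head_apply_congr (fun v => ih v) v u
    rw [this]

theorem mem_range_lTensor (S : Submodule K X) (t : V ⊗[K] X)
    (h : ∀ φ : V →ₗ[K] K, TensorProduct.lid K X (φ.rTensor X t) ∈ S) :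
    t ∈ LinearMap.range (S.subtype.lTensor V) := by
  classical
  let b := Module.Basis.ofVectorSpace K V
  rw [← (TensorProduct.equivFinsuppOfBasisLeft (N := X) b).symm_apply_apply t,
    TensorProduct.equivFinsuppOfBasisLeft_symm_apply]
  refine Submodule.sum_mem _ fun i _ => ?_
  rw [TensorProduct.equivFinsuppOfBasisLeft_apply]
  exact ⟨b i ⊗ₜ ⟨_, h (b.coord i)⟩, by simp⟩

theorem mem_range_rTensor (S : Submodule K X) (t : X ⊗[K] V)
    (h : ∀ φ : V →ₗ[K] K, TensorProduct.rid K X (φ.lTensor X t) ∈ S) :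
    t ∈ LinearMap.range (S.subtype.rTensor V) := by
  classical
  let b := Module.Basis.ofVectorSpace K V
  rw [← (TensorProduct.equivFinsuppOfBasisRight (M := X) b).symm_apply_apply t,
    TensorProduct.equivFinsuppOfBasisRight_symm_apply]
  refine Submodule.sum_mem _ fun i _ => ?_
  rw [TensorProduct.equivFinsuppOfBasisRight_apply]
  exact ⟨⟨_, h (b.coord i)⟩ ⊗ₜ b i, by simp⟩

theorem lid_rTensor_lTensor (f : X →ₗ[K] Y) (φ : V →ₗ[K] K) (t : V ⊗[K] X) :
    f (TensorProduct.lid K X (φ.rTensor X t)) =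
      TensorProduct.lid K Y (φ.rTensor Y (f.lTensor V t)) := by
  induction t with
  | zero => simp
  | add a b ha hb => simp only [map_add, ha, hb]
  | tmul v x => simp

theorem rid_lTensor_rTensor (f : X →ₗ[K] Y) (φ : V →ₗ[K] K) (t : X ⊗[K] V) :
    f (TensorProduct.rid K X (φ.lTensor X t)) =
      TensorProduct.rid K Y (φ.lTensor Y (f.rTensor V t)) := by
  induction t with
  | zero => simp
  | add a b ha hb => simp only [map_add, ha, hb]
  | tmul v x => simp

theorem mem_En_iff {n : ℕ} (hn : 2 ≤ n) {x : TensorAlgebra K V} :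
    x ∈ c.En n ↔ degProj K V n x = x ∧
      ∀ p q, 1 ≤ p → 1 ≤ q → p + q = n → c.comulPart p q x = 0 := by
  rw [En, if_neg (by omega)]
  simp [mem_degPart_iff, Submodule.mem_iInf]

theorem lTensor_comulPart_braidWith (p q : ℕ) (w : V) (x : TensorAlgebra K V) :
    (c.comulPart p q).lTensor V (c.braidWith w x) =
      c.braidWith₂ w (c.comulPart p q x) := by
  have h : ∀ z, (TensorProduct.map (degProj K V p) (degProj K V q)).lTensor V
      (c.braidWith₂ w z) =
      c.braidWith₂ w (TensorProduct.map (degProj K V p) (degProj K V q) z) := by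
    intro z
    induction z with
    | zero => simp
    | add a b ha hb => simp only [map_add, ha, hb]
    | tmul x y =>
      rw [map_tmul, braidWith₂_tmul, braidWith₂_tmul, ← braidWith_degProj]
      generalize c.braidWith w y = t
      induction t with
      | zero => simp
      | add a b ha hb => simp only [map_add, tmul_add, ha, hb]
      | tmul a y =>
        simp only [assoc_symm_tmul, LinearMap.rTensor_tmul, LinearMap.lTensor_tmul,
          ← braidWith_apply, ← braidWith_degProj]
        generalize c.braidWith a x = t
        induction t with
        | zero => simp
        | add a b ha hb => simp only [map_add, add_tmul, ha, hb]
        | tmul a x => simp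
  rw [comulPart, LinearMap.lTensor_comp, LinearMap.comp_apply, braidWith_comul, h,
    LinearMap.comp_apply]

theorem rTensor_comulPart_braidVT (p q : ℕ) (v : V) (x : TensorAlgebra K V) :
    (c.comulPart p q).rTensor V (c.braidVT (v ⊗ₜ x)) =
      c.braidVTT (v ⊗ₜ c.comulPart p q x) := by
  have h : ∀ z, (TensorProduct.map (degProj K V p) (degProj K V q)).rTensor V
      (c.braidVTT (v ⊗ₜ z)) =
      c.braidVTT (v ⊗ₜ TensorProduct.map (degProj K V p) (degProj K V q) z) := by
    intro z
    induction z with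
    | zero => simp
    | add a b ha hb => simp only [map_add, tmul_add, ha, hb]
    | tmul x y =>
      simp only [map_tmul, braidVTT, LinearMap.comp_apply, braidFst_tmul, ← braidVT_degProj]
      generalize c.braidVT (v ⊗ₜ x) = t
      induction t with
      | zero => simp
      | add a b ha hb => simp only [map_add, add_tmul, ha, hb]
      | tmul x v =>
        simp only [assoc_tmul, LinearMap.rTensor_tmul, LinearMap.lTensor_tmul, ← braidVT_degProj]
        generalize c.braidVT (v ⊗ₜ y) = t
        induction t with
        | zero => simp
        | add a b ha hb => simp only [map_add, tmul_add, ha, hb]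
        | tmul a x => simp
  rw [comulPart, LinearMap.rTensor_comp, LinearMap.comp_apply, braidVT_comul, h,
    LinearMap.comp_apply]

theorem braidTV_mem {x : TensorAlgebra K V} (hx : x ∈ c.E) (w : V) :
    c.braidTV (x ⊗ₜ w) ∈ LinearMap.range (c.E.subtype.lTensor V) := by
  rw [← braidWith_apply]
  apply mem_range_lTensor
  intro φ
  induction hx using Submodule.iSup_induction' with
  | zero => simp
  | add x y _ _ hx hy => simpa only [map_add] using add_mem hx hy
  | mem n x hx =>
    refine Submodule.mem_iSup_of_mem n ?_
    by_cases hn : n ≤ 1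
    · rw [En, if_pos hn] at hx ⊢
      simp [(Submodule.mem_bot K).mp hx]
    · rw [mem_En_iff _ (by omega)] at hx ⊢
      refine ⟨?_, fun p q hp hq hpq => ?_⟩
      · rw [lid_rTensor_lTensor, braidWith_degProj, hx.1]
      · rw [lid_rTensor_lTensor, lTensor_comulPart_braidWith, hx.2 p q hp hq hpq]
        simp

theorem braidVT_mem {x : TensorAlgebra K V} (hx : x ∈ c.E) (v : V) :
    c.braidVT (v ⊗ₜ x) ∈ LinearMap.range (c.E.subtype.rTensor V) := by
  apply mem_range_rTensor
  intro φ
  induction hx using Submodule.iSup_induction' with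
  | zero => simp
  | add x y _ _ hx hy => simpa only [map_add, tmul_add] using add_mem hx hy
  | mem n x hx =>
    refine Submodule.mem_iSup_of_mem n ?_
    by_cases hn : n ≤ 1
    · rw [En, if_pos hn] at hx ⊢
      simp [(Submodule.mem_bot K).mp hx]
    · rw [mem_En_iff _ (by omega)] at hx ⊢
      refine ⟨?_, fun p q hp hq hpq => ?_⟩
      · rw [rid_lTensor_rTensor, braidVT_degProj, hx.1]
      · rw [rid_lTensor_rTensor, rTensor_comulPart_braidVT, hx.2 p q hp hq hpq]
        simp

/-! ### Restriction of a map to submodules of the domain and codomain -/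

theorem lTensor_subtype_injective (S : Submodule K X) :
    Function.Injective (S.subtype.lTensor V) :=
  Module.Flat.lTensor_preserves_injective_linearMap _ S.injective_subtype

theorem rTensor_subtype_injective (S : Submodule K X) :
    Function.Injective (S.subtype.rTensor V) :=
  Module.Flat.rTensor_preserves_injective_linearMap _ S.injective_subtype

/-- The restriction `S ⊗ V → V ⊗ S` of `f : X ⊗ V → V ⊗ X`, for a subspace `S` of `X` with
`f (S ⊗ V) ⊆ V ⊗ S`. -/
noncomputable def restrictRight (S : Submodule K X) (f : X ⊗[K] V →ₗ[K] V ⊗[K] X)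
    (h : ∀ x ∈ S, ∀ v, f (x ⊗ₜ v) ∈ LinearMap.range (S.subtype.lTensor V)) :
    S ⊗[K] V →ₗ[K] V ⊗[K] S :=
  (LinearEquiv.ofInjective _ (lTensor_subtype_injective S)).symm.toLinearMap ∘ₗ
    (f ∘ₗ S.subtype.rTensor V).codRestrict _ (fun t => by
      induction t with
      | zero => simp
      | add a b ha hb => simpa only [map_add] using add_mem ha hb
      | tmul x v => simpa using h x.1 x.2 v)

theorem lTensor_subtype_restrictRight (S : Submodule K X) (f : X ⊗[K] V →ₗ[K] V ⊗[K] X) (h)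
    (t : S ⊗[K] V) : S.subtype.lTensor V (restrictRight S f h t) = f (S.subtype.rTensor V t) := by
  have := LinearEquiv.apply_symm_apply
    (LinearEquiv.ofInjective _ (lTensor_subtype_injective (V := V) S))
    ((f ∘ₗ S.subtype.rTensor V).codRestrict (LinearMap.range (S.subtype.lTensor V)) (fun t => by
      induction t with
      | zero => simp
      | add a b ha hb => simpa only [map_add] using add_mem ha hb
      | tmul x v => simpa using h x.1 x.2 v) t)
  exact congrArg Subtype.val this

/-- The restriction `V ⊗ S → S ⊗ V` of `f : V ⊗ X → X ⊗ V`, for a subspace `S` of `X` with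
`f (V ⊗ S) ⊆ S ⊗ V`. -/
noncomputable def restrictLeft (S : Submodule K X) (f : V ⊗[K] X →ₗ[K] X ⊗[K] V)
    (h : ∀ x ∈ S, ∀ v, f (v ⊗ₜ x) ∈ LinearMap.range (S.subtype.rTensor V)) :
    V ⊗[K] S →ₗ[K] S ⊗[K] V :=
  (LinearEquiv.ofInjective _ (rTensor_subtype_injective S)).symm.toLinearMap ∘ₗ
    (f ∘ₗ S.subtype.lTensor V).codRestrict _ (fun t => by
      induction t with
      | zero => simp
      | add a b ha hb => simpa only [map_add] using add_mem ha hb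
      | tmul v x => simpa using h x.1 x.2 v)

theorem rTensor_subtype_restrictLeft (S : Submodule K X) (f : V ⊗[K] X →ₗ[K] X ⊗[K] V) (h)
    (t : V ⊗[K] S) : S.subtype.rTensor V (restrictLeft S f h t) = f (S.subtype.lTensor V t) := by
  have := LinearEquiv.apply_symm_apply
    (LinearEquiv.ofInjective _ (rTensor_subtype_injective (V := V) S))
    ((f ∘ₗ S.subtype.lTensor V).codRestrict (LinearMap.range (S.subtype.rTensor V)) (fun t => by
      induction t with
      | zero => simp
      | add a b ha hb => simpa only [map_add] using add_mem ha hb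
      | tmul v x => simpa using h x.1 x.2 v) t)
  exact congrArg Subtype.val this

/-! ### Brackets, the universal enveloping algebra and braided Lie algebras -/

/-- The map `c_{E, V} : E ⊗ V → V ⊗ E` induced by the braiding of `T(V, c)`. -/
noncomputable def braidEV : c.E ⊗[K] V →ₗ[K] V ⊗[K] c.E :=
  restrictRight c.E c.braidTV fun _ hx w => c.braidTV_mem hx w

/-- The map `c_{V, E} : V ⊗ E → E ⊗ V` induced by the braiding of `T(V, c)`. -/
noncomputable def braidVE : V ⊗[K] c.E →ₗ[K] c.E ⊗[K] V :=
  restrictLeft c.E c.braidVT fun _ hx v => c.braidVT_mem hx v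

/-- A (braided) bracket on `(V, c)`: a linear map `b : E(V, c) → V` with
`c (b ⊗ V) = (V ⊗ b) c_{E, V}` and `c (V ⊗ b) = (b ⊗ V) c_{V, E}`. -/
structure IsBracket (b : c.E →ₗ[K] V) : Prop where
  left : c.c ∘ₗ b.rTensor V = b.lTensor V ∘ₗ c.braidEV
  right : c.c ∘ₗ b.lTensor V = b.rTensor V ∘ₗ c.braidVE

/-- The two-sided ideal of `T(V)` generated by `(Id - b)[E(V, c)]`. -/
def envelopingIdeal (b : c.E →ₗ[K] V) : TwoSidedIdeal (TensorAlgebra K V) :=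
  TwoSidedIdeal.span {t | ∃ z : c.E, t = (z : TensorAlgebra K V) - ι K (b z)}

/-- The universal enveloping algebra `U(V, c, b) = T(V, c) / ((Id - b)[E(V, c)])`. -/
abbrev U (b : c.E →ₗ[K] V) : Type _ := (c.envelopingIdeal b).ringCon.Quotient

/-- The canonical projection `π_U : T(V, c) → U(V, c, b)`. -/
def projU (b : c.E →ₗ[K] V) : TensorAlgebra K V →ₐ[K] c.U b :=
  (c.envelopingIdeal b).ringCon.mkₐ K

/-- The canonical map `i_U : V → U(V, c, b)`. -/
noncomputable def inclU (b : c.E →ₗ[K] V) : V →ₗ[K] c.U b :=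
  (c.projU b).toLinearMap ∘ₗ ι K

/-- `(V, c, b)` is a braided Lie algebra: `b` is a bracket on the braided vector space `(V, c)` and
the canonical map `i_U : V → U(V, c, b)` is injective. -/
structure IsBraidedLieAlgebra (b : c.E →ₗ[K] V) : Prop where
  isBracket : c.IsBracket b
  inclU_injective : Function.Injective (c.inclU b)

/-! ### Quadratic Lie algebras -/

/-- `E₂(V, c) = ker (c + Id)`, as a subspace of `V ⊗ V`. -/
def E₂ : Submodule K (V ⊗[K] V) := LinearMap.ker (c.c + LinearMap.id)

theorem mem_E₂ {z : V ⊗[K] V} : z ∈ c.E₂ ↔ c.c z = -z := by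
  simp [E₂, add_eq_zero_iff_eq_neg]

theorem comulPart_ι₂ (z : V ⊗[K] V) :
    c.comulPart 1 1 (ι₂ K V z) = TensorProduct.map (ι K) (ι K) (c.c z + z) := by
  induction z with
  | zero => simp
  | add x y hx hy => simp only [map_add, hx, hy]; abel
  | tmul v w =>
    have h1 : ∀ u : V, degProj K V 1 (ι K u) = ι K u := fun u => degProj_of_mem (ι_mem_degPart u)
    have h2 : ∀ u w : V, degProj K V 1 (ι K u * ι K w) = 0 := fun u w => by
      rw [degProj_succ_ι_mul 0, ← mul_one (ι K w), degProj_zero_ι_mul, mul_zero]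
    have hw : c.comul (ι K w) = ι K w ⊗ₜ 1 + 1 ⊗ₜ ι K w := by
      rw [← mul_one (ι K w), comul_ι_mul]; simp [lmulSnd]
    have hb : c.braidVT (v ⊗ₜ ι K w) = (ι K).rTensor V (c.c (v ⊗ₜ w)) := by
      rw [← mul_one (ι K w), braidVT_ι_mul, head_tmul]
      generalize c.c (v ⊗ₜ w) = t
      induction t with
      | zero => simp
      | add a b ha hb => simp only [map_add, add_tmul, ha, hb]
      | tmul a b => simp
    have h0 : ∀ u : V, degProj K V 0 (ι K u) = 0 := fun u => by
      rw [← mul_one (ι K u), degProj_zero_ι_mul]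
    rw [ι₂_tmul, comulPart, LinearMap.comp_apply, comul_ι_mul, hw]
    simp only [lmulSnd, tmul_add, map_add, lmulTensor_tmul, LinearMap.comp_apply,
      LinearEquiv.coe_coe, assoc_symm_tmul, LinearMap.rTensor_tmul, hb, braidVT_one, assoc_tmul,
      LinearMap.lTensor_tmul, lmul_tmul, map_tmul, h1, h2, mul_one, degProj_succ_one,
      tmul_zero, zero_add, add_zero]
    rw [add_comm]
    congr 1
    generalize c.c (v ⊗ₜ w) = t
    induction t with
    | zero => simp
    | add a b ha hb => simp only [map_add, add_tmul, ha, hb]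
    | tmul a b => simp [h1]

theorem ι₂_injective : Function.Injective (ι₂ K V) := by
  have h : ∀ z : V ⊗[K] V, Braiding.comulPart ⟨0, by simp⟩ 1 1 (ι₂ K V z) =
      TensorProduct.map (ι K) (ι K) z := fun z => by rw [comulPart_ι₂]; simp
  have hinj : Function.Injective (TensorProduct.map (ι K (M := V)) (ι K (M := V))) :=
    TensorProduct.map_injective_of_flat_flat' _ _ ι_leftInverse.injective
      ι_leftInverse.injective
  intro z z' hz
  apply hinj
  rw [← h, ← h, hz]

theorem ι₂_mem_degPart (z : V ⊗[K] V) : ι₂ K V z ∈ degPart K V 2 := by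
  induction z with
  | zero => simp
  | add x y hx hy => simpa only [map_add] using add_mem hx hy
  | tmul v w =>
    rw [ι₂_tmul]
    exact mul_mem_degPart (n := 1) (m := 1) (ι_mem_degPart v) (ι_mem_degPart w)

/-- `E₂(V, c) = ker (Δ^{1,1}) = ker (c + Id)`. -/
theorem En_two : c.En 2 = c.E₂.map (ι₂ K V) := by
  have hinj : Function.Injective (TensorProduct.map (ι K (M := V)) (ι K (M := V))) :=
    TensorProduct.map_injective_of_flat_flat' _ _ ι_leftInverse.injective
      ι_leftInverse.injective
  have hz : ∀ z, c.comulPart 1 1 (ι₂ K V z) = 0 ↔ z ∈ c.E₂ := fun z => by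
    rw [comulPart_ι₂, map_eq_zero_iff _ hinj, mem_E₂, add_eq_zero_iff_eq_neg]
  ext x
  rw [mem_En_iff _ le_rfl, ← mem_degPart_iff, Submodule.mem_map]
  constructor
  · rintro ⟨hx, h⟩
    have hx' : x ∈ LinearMap.range (ι₂ K V) := by
      rw [degPart, pow_two] at hx
      refine Submodule.mul_le.mpr ?_ hx
      rintro _ ⟨v, rfl⟩ _ ⟨w, rfl⟩
      exact ⟨v ⊗ₜ w, ι₂_tmul v w⟩
    obtain ⟨z, rfl⟩ := hx'
    exact ⟨z, (hz z).mp (h 1 1 le_rfl le_rfl rfl), rfl⟩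
  · rintro ⟨z, hzE, rfl⟩
    refine ⟨ι₂_mem_degPart z, fun p q hp hq hpq => ?_⟩
    obtain rfl : p = 1 := by omega
    obtain rfl : q = 1 := by omega
    exact (hz z).mpr hzE

theorem head_yang_baxter' (z : V ⊗[K] (V ⊗[K] V)) :
    c.head V (c.c.lTensor V (c.head V z)) = c.c.lTensor V (c.head V (c.c.lTensor V z)) := by
  have := LinearMap.congr_fun c.yang_baxter ((TensorProduct.assoc K V V V).symm z)
  simpa [head] using congrArg (TensorProduct.assoc K V V V) this

theorem lTensor_c_of_E₂ (z : V ⊗[K] c.E₂) :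
    c.c.lTensor V (c.E₂.subtype.lTensor V z) = -c.E₂.subtype.lTensor V z := by
  induction z with
  | zero => simp
  | add x y hx hy => simp only [map_add, hx, hy]; abel
  | tmul v z => simp [(c.mem_E₂).mp z.2, tmul_neg]

theorem braid₂₁_mem {z : V ⊗[K] V} (hz : z ∈ c.E₂) (w : V) :
    c.head V (c.c.lTensor V (TensorProduct.assoc K V V V (z ⊗ₜ w))) ∈
      LinearMap.range (c.E₂.subtype.lTensor V) := by
  apply mem_range_lTensor
  intro φ
  have h : c.head V (TensorProduct.assoc K V V V (z ⊗ₜ w)) =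
      -TensorProduct.assoc K V V V (z ⊗ₜ w) := by
    simp [head, (c.mem_E₂).mp hz, neg_tmul]
  rw [mem_E₂, lid_rTensor_lTensor, ← head_yang_baxter', h]
  simp

theorem braid₁₂_mem {z : V ⊗[K] V} (hz : z ∈ c.E₂) (v : V) :
    (TensorProduct.assoc K V V V).symm (c.c.lTensor V (c.head V (v ⊗ₜ z))) ∈
      LinearMap.range (c.E₂.subtype.rTensor V) := by
  apply mem_range_rTensor
  intro φ
  have h : c.c.lTensor V (v ⊗ₜ z) = -(v ⊗ₜ z) := by
    simp [(c.mem_E₂).mp hz, tmul_neg]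
  have h' : ∀ y, c.c.rTensor V ((TensorProduct.assoc K V V V).symm y) =
      (TensorProduct.assoc K V V V).symm (c.head V y) := fun y => by simp [head]
  rw [mem_E₂, rid_lTensor_rTensor, h', head_yang_baxter', h]
  simp

/-- The map `c_{E₂, V} : E₂ ⊗ V → V ⊗ E₂` induced by `c₁ c₂ = c_{V ⊗ V, V}`. -/
noncomputable def braidE₂V : c.E₂ ⊗[K] V →ₗ[K] V ⊗[K] c.E₂ :=
  restrictRight c.E₂
    (c.head V ∘ₗ c.c.lTensor V ∘ₗ (TensorProduct.assoc K V V V).toLinearMap)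
    fun _ hz w => c.braid₂₁_mem hz w

/-- The map `c_{V, E₂} : V ⊗ E₂ → E₂ ⊗ V` induced by `c₂ c₁ = c_{V, V ⊗ V}`. -/
noncomputable def braidVE₂ : V ⊗[K] c.E₂ →ₗ[K] c.E₂ ⊗[K] V :=
  restrictLeft c.E₂
    ((TensorProduct.assoc K V V V).symm.toLinearMap ∘ₗ c.c.lTensor V ∘ₗ c.head V)
    fun _ hz v => c.braid₁₂_mem hz v

/-- A quadratic bracket on `(V, c)`: a linear map `β : E₂(V, c) → V` with
`c (β ⊗ V) = (V ⊗ β) c_{E₂, V}` and `c (V ⊗ β) = (β ⊗ V) c_{V, E₂}`. -/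
structure IsQBracket (β : c.E₂ →ₗ[K] V) : Prop where
  left : c.c ∘ₗ β.rTensor V = β.lTensor V ∘ₗ c.braidE₂V
  right : c.c ∘ₗ β.lTensor V = β.rTensor V ∘ₗ c.braidVE₂

/-- `(V, c, β)` is a quadratic Lie algebra: `β` is a quadratic bracket on the braided vector space
`(V, c)` such that `β (β ⊗ V - V ⊗ β) = 0` on `(E₂ ⊗ V) ∩ (V ⊗ E₂) ⊆ V ⊗ V ⊗ V`. An element of
this intersection is given by its two representatives `x ∈ E₂ ⊗ V` and `y ∈ V ⊗ E₂`; that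
`(β ⊗ V) x - (V ⊗ β) y` lies in the domain `E₂` of `β` is part of the condition. -/
structure IsQLieAlgebra (β : c.E₂ →ₗ[K] V) : Prop where
  isQBracket : c.IsQBracket β
  jacobi : ∀ (x : c.E₂ ⊗[K] V) (y : V ⊗[K] c.E₂),
    TensorProduct.assoc K V V V (c.E₂.subtype.rTensor V x) = c.E₂.subtype.lTensor V y →
    ∃ h : β.rTensor V x - β.lTensor V y ∈ c.E₂, β ⟨β.rTensor V x - β.lTensor V y, h⟩ = 0

/-- The two-sided ideal of `T(V)` generated by `(Id - β)[E₂(V, c)]`. -/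
def quadEnvelopingIdeal (β : c.E₂ →ₗ[K] V) : TwoSidedIdeal (TensorAlgebra K V) :=
  TwoSidedIdeal.span {t | ∃ z : c.E₂, t = ι₂ K V z - ι K (β z)}

/-- The quadratic universal enveloping algebra
`U_Q(V, c, β) = T(V, c) / ((Id - β)[E₂(V, c)])`. -/
abbrev UQ (β : c.E₂ →ₗ[K] V) : Type _ := (c.quadEnvelopingIdeal β).ringCon.Quotient

/-- The canonical projection `T(V, c) → U_Q(V, c, β)`. -/
def projUQ (β : c.E₂ →ₗ[K] V) : TensorAlgebra K V →ₐ[K] c.UQ β :=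
  (c.quadEnvelopingIdeal β).ringCon.mkₐ K

theorem ι₂_mem_E {z : V ⊗[K] V} (hz : z ∈ c.E₂) : ι₂ K V z ∈ c.E :=
  Submodule.mem_iSup_of_mem 2 (c.En_two ▸ Submodule.mem_map_of_mem hz)

/-- The restriction `b² : E₂(V, c) → V` of `b : E(V, c) → V`. -/
noncomputable def restrictE₂ (b : c.E →ₗ[K] V) : c.E₂ →ₗ[K] V :=
  b ∘ₗ (ι₂ K V ∘ₗ c.E₂.subtype).codRestrict c.E fun z => c.ι₂_mem_E z.2

/-! ### The Nichols algebra -/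

/-- One step of the recursion for `shuffle`. -/
noncomputable def shuffleStep : V →ₗ[K]
    Module.End K (TensorAlgebra K V × (V →ₗ[K] TensorAlgebra K V)) :=
  LinearMap.mk₂ K (fun u p => (ι K u * p.1,
      (LinearMap.mul K (TensorAlgebra K V)).flip (ι K u * p.1) ∘ₗ ι K +
      lmul K V ∘ₗ p.2.lTensor V ∘ₗ c.c ∘ₗ (TensorProduct.mk K V V).flip u))
    (fun _ _ _ => by
      ext <;> simp [add_mul, mul_add, tmul_add, add_add_add_comm])
    (fun _ _ _ => by ext <;> simp)
    (fun _ _ _ => by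
      ext <;> simp [mul_add, LinearMap.lTensor_add, add_add_add_comm])
    (fun _ _ _ => by ext <;> simp)

theorem shuffleStep_apply (u : V) (p : TensorAlgebra K V × (V →ₗ[K] TensorAlgebra K V)) :
    c.shuffleStep u p = (ι K u * p.1,
      (LinearMap.mul K (TensorAlgebra K V)).flip (ι K u * p.1) ∘ₗ ι K +
      lmul K V ∘ₗ p.2.lTensor V ∘ₗ c.c ∘ₗ (TensorProduct.mk K V V).flip u) := rfl

/-- The quantum shuffle product `v * x` of `v ∈ V` and `x ∈ T(V)`, i.e. the sum over all ways of
inserting `v` into `x` of the result of moving `v` to its place by the braiding. It is given by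
`v * 1 = v` and, for `u ∈ V`, `v * (u ⊗ x) = v ⊗ u ⊗ x + u' ⊗ (v' * x)` where
`c (v ⊗ u) = u' ⊗ v'`. -/
noncomputable def shuffle : V ⊗[K] TensorAlgebra K V →ₗ[K] TensorAlgebra K V :=
  TensorProduct.lift (LinearMap.snd K _ _ ∘ₗ leftRec c.shuffleStep (1, ι K)).flip

@[simp]
theorem shuffle_one (v : V) : c.shuffle (v ⊗ₜ 1) = ι K v := by
  simp [shuffle]

theorem shuffle_ι_mul (v u : V) (x : TensorAlgebra K V) :
    c.shuffle (v ⊗ₜ (ι K u * x)) =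
      ι K v * (ι K u * x) + lmul K V (c.shuffle.lTensor V (c.head _ (v ⊗ₜ (u ⊗ₜ x)))) := by
  have h : ∀ x, (leftRec c.shuffleStep (1, ι K) x).1 = x := by
    intro x
    induction x using left_induction with
    | one => simp
    | add x y hx hy => simp [hx, hy]
    | smul k x hx => simp [hx]
    | ι_mul v x hx => simp [shuffleStep_apply, hx]
  rw [head_tmul, lTensor_assoc_congr (g := (leftRec c.shuffleStep (1, ι K) x).2)
    (fun w => by simp [shuffle])]
  simp [shuffle, shuffleStep_apply, h]

/-- The algebra homomorphism `Γ` from the tensor algebra `T(V, c)` to the quantum shuffle algebra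
`T^c(V, c)`, whose underlying vector space is that of `T(V)`, with `Γ v = v` for `v ∈ V`; it is
given through `Γ 1 = 1` and `Γ (v ⊗ x) = v * Γ x`, where `*` is the quantum shuffle product. -/
noncomputable def gamma : TensorAlgebra K V →ₗ[K] TensorAlgebra K V :=
  leftRec (TensorProduct.curry c.shuffle) 1

@[simp]
theorem gamma_one : c.gamma 1 = 1 := by simp [gamma]

theorem gamma_ι_mul (v : V) (x : TensorAlgebra K V) :
    c.gamma (ι K v * x) = c.shuffle (v ⊗ₜ c.gamma x) := by
  simp [gamma]

theorem shuffle_comp_lmul :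
    c.shuffle ∘ₗ (lmul K V).lTensor V =
      lmul K V ∘ₗ (lmul K V).lTensor V + lmul K V ∘ₗ c.shuffle.lTensor V ∘ₗ c.head _ := by
  ext v u x
  simp [shuffle_ι_mul]

theorem braidWith_shuffle (w v : V) (x : TensorAlgebra K V) :
    c.braidWith w (c.shuffle (v ⊗ₜ x)) =
      c.shuffle.lTensor V (c.head _ (v ⊗ₜ c.braidWith w x)) := by
  induction x using left_induction generalizing v with
  | one =>
    rw [shuffle_one, braidWith_one, ← mul_one (ι K v), braidWith_ι_mul, braidWith_one]
    exact c.lTensor_head_congr (by simp) v w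
  | add x y hx hy => simp only [map_add, tmul_add, hx, hy]
  | smul k x hx => simp only [map_smul, tmul_smul, hx]
  | ι_mul u x ih =>
    have e : ∀ z, c.braidWith w (lmul K V z) =
        (lmul K V).lTensor V (c.head _ ((c.braidWith w).lTensor V z)) :=
      fun z => LinearMap.congr_fun (c.braidWith_comp_lmul w) z
    have e₁ : (c.braidWith w ∘ₗ c.shuffle).lTensor V (c.head _ (v ⊗ₜ (u ⊗ₜ x))) =
        (c.shuffle.lTensor V ∘ₗ c.head _).lTensor V
          (c.head _ (v ⊗ₜ (u ⊗ₜ c.braidWith w x))) :=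
      c.lTensor_head_apply_congr (fun v => ih v) v u
    have e₂ : v ⊗ₜ[K] (lmul K V).lTensor V (c.head _ (u ⊗ₜ c.braidWith w x)) =
        ((lmul K V).lTensor V).lTensor V (v ⊗ₜ c.head _ (u ⊗ₜ c.braidWith w x)) := by simp
    rw [shuffle_ι_mul, map_add, braidWith_ι_mul, braidWith_ι_mul, e, lTensor_comp_apply, e₁, e₂,
      ← head_naturality, lTensor_comp_apply (c.shuffle), shuffle_comp_lmul, LinearMap.lTensor_add,
      LinearMap.add_apply, LinearMap.lTensor_comp _ (lmul K V) ((lmul K V).lTensor V),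
      LinearMap.comp_apply]
    congr 1
    rw [LinearMap.lTensor_comp, LinearMap.comp_apply, ← head_naturality, LinearMap.lTensor_comp,
      LinearMap.lTensor_comp, LinearMap.comp_apply, LinearMap.comp_apply, head_yang_baxter,
      LinearMap.lTensor_tmul]

/-- One step of the recursion for `rshuffle`. -/
noncomputable def rshuffleStep (w : V) : V →ₗ[K]
    Module.End K (TensorAlgebra K V × TensorAlgebra K V) :=
  LinearMap.mk₂ K (fun u p => (ι K u * p.1,
      ι K u * p.2 + lmul K V (c.braidWith w (ι K u * p.1))))
    (fun _ _ _ => by ext <;> simp [add_mul, add_add_add_comm])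
    (fun _ _ _ => by ext <;> simp)
    (fun _ _ _ => by ext <;> simp [mul_add, add_add_add_comm])
    (fun _ _ _ => by ext <;> simp)

theorem rshuffleStep_apply (w u : V) (p : TensorAlgebra K V × TensorAlgebra K V) :
    c.rshuffleStep w u p = (ι K u * p.1,
      ι K u * p.2 + lmul K V (c.braidWith w (ι K u * p.1))) := rfl

/-- The quantum shuffle product `x * w` of `x ∈ T(V)` and `w ∈ V`. -/
noncomputable def rshuffle (w : V) : TensorAlgebra K V →ₗ[K] TensorAlgebra K V :=
  LinearMap.snd K _ _ ∘ₗ leftRec (c.rshuffleStep w) (1, ι K w)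

theorem rshuffle_one (w : V) : c.rshuffle w 1 = ι K w := by simp [rshuffle]

theorem rshuffle_ι_mul (w u : V) (x : TensorAlgebra K V) :
    c.rshuffle w (ι K u * x) =
      ι K u * c.rshuffle w x + lmul K V (c.braidWith w (ι K u * x)) := by
  have h : ∀ x, (leftRec (c.rshuffleStep w) (1, ι K w) x).1 = x := by
    intro x
    induction x using left_induction with
    | one => simp
    | add x y hx hy => simp [hx, hy]
    | smul k x hx => simp [hx]
    | ι_mul v x hx => simp [rshuffleStep_apply, hx]
  simp [rshuffle, rshuffleStep_apply, h]

theorem shuffle_rshuffle (w v : V) (x : TensorAlgebra K V) :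
    c.shuffle (v ⊗ₜ c.rshuffle w x) = c.rshuffle w (c.shuffle (v ⊗ₜ x)) := by
  induction x using left_induction generalizing v with
  | one =>
    rw [rshuffle_one, shuffle_one, ← mul_one (ι K v), rshuffle_ι_mul, rshuffle_one,
      ← mul_one (ι K w), shuffle_ι_mul, braidWith_ι_mul, braidWith_one]
    congr 2
    exact c.lTensor_head_congr (by simp) v w
  | add x y hx hy => simp only [map_add, tmul_add, hx, hy]
  | smul k x hx => simp only [map_smul, tmul_smul, hx]
  | ι_mul u x ih =>
    have e₁ : (c.shuffle).lTensor V (c.head _ (v ⊗ₜ (u ⊗ₜ c.rshuffle w x))) =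
        (c.rshuffle w ∘ₗ c.shuffle).lTensor V (c.head _ (v ⊗ₜ (u ⊗ₜ x))) :=
      c.lTensor_head_apply_congr (fun v => ih v) v u
    have e₂ : ∀ z, c.shuffle (v ⊗ₜ lmul K V z) = ι K v * lmul K V z +
        lmul K V (c.shuffle.lTensor V (c.head _ (v ⊗ₜ z))) := by
      intro z
      simpa using LinearMap.congr_fun c.shuffle_comp_lmul (v ⊗ₜ z)
    have e₃ : ∀ z, c.rshuffle w (lmul K V z) = lmul K V ((c.rshuffle w).lTensor V z) +
        lmul K V (c.braidWith w (lmul K V z)) := by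
      intro z
      induction z with
      | zero => simp
      | add a b ha hb => simp only [map_add, ha, hb]; abel
      | tmul a b => simp [rshuffle_ι_mul]
    have e₄ := c.braidWith_shuffle w v (ι K u * x)
    rw [shuffle_ι_mul, map_add] at e₄
    rw [rshuffle_ι_mul, tmul_add, map_add, shuffle_ι_mul, e₁, e₂, ← e₄, shuffle_ι_mul,
      map_add (c.rshuffle w), c.rshuffle_ι_mul w v, c.rshuffle_ι_mul w u, e₃, lTensor_comp_apply, map_add, mul_add]
    abel

theorem gamma_mul_ι (x : TensorAlgebra K V) (w : V) :
    c.gamma (x * ι K w) = c.rshuffle w (c.gamma x) := by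
  induction x using left_induction with
  | one => rw [one_mul, gamma_one, rshuffle_one, ← mul_one (ι K w), gamma_ι_mul]; simp
  | add x y hx hy => simp only [add_mul, map_add, hx, hy]
  | smul k x hx => simp only [smul_mul_assoc, map_smul, hx]
  | ι_mul v x hx => rw [mul_assoc, gamma_ι_mul, hx, shuffle_rshuffle, gamma_ι_mul]

theorem gamma_mul_left {y : TensorAlgebra K V} (hy : c.gamma y = 0) (x : TensorAlgebra K V) :
    c.gamma (x * y) = 0 := by
  induction x using left_induction with
  | one => simpa
  | add x₁ x₂ h₁ h₂ => simp [add_mul, h₁, h₂]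
  | smul k x hx => simp [hx]
  | ι_mul v x hx => rw [mul_assoc, gamma_ι_mul, hx]; simp

theorem gamma_mul_right {x : TensorAlgebra K V} (hx : c.gamma x = 0) (y : TensorAlgebra K V) :
    c.gamma (x * y) = 0 := by
  induction y using TensorAlgebra.induction generalizing x with
  | algebraMap r => rw [← Algebra.commutes, ← Algebra.smul_def]; simp [hx]
  | ι w => rw [gamma_mul_ι, hx, map_zero]
  | mul a b ha hb => rw [← mul_assoc]; exact hb (ha hx)
  | add a b ha hb => rw [mul_add, map_add, ha hx, hb hx, add_zero]

/-- The kernel of `Γ`, as a two-sided ideal of `T(V)`. -/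
noncomputable def nicholsIdeal : TwoSidedIdeal (TensorAlgebra K V) :=
  TwoSidedIdeal.mk' {x | c.gamma x = 0} (by simp)
    (fun {x y} hx hy => by simp_all) (fun {x} hx => by simp_all)
    (fun {x y} hy => c.gamma_mul_left hy x) (fun {x y} hx => c.gamma_mul_right hx y)

theorem mem_nicholsIdeal {x : TensorAlgebra K V} : x ∈ c.nicholsIdeal ↔ c.gamma x = 0 := by
  simp [nicholsIdeal]

/-- The Nichols algebra `B(V, c) = T(V, c) / ker Γ ≃ Im Γ`. -/
abbrev NicholsAlgebra : Type _ := c.nicholsIdeal.ringCon.Quotient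

/-- The canonical projection `T(V, c) → B(V, c)`. -/
noncomputable def nicholsProj : TensorAlgebra K V →ₐ[K] c.NicholsAlgebra :=
  c.nicholsIdeal.ringCon.mkₐ K

theorem nicholsProj_surjective : Function.Surjective c.nicholsProj :=
  c.nicholsIdeal.ringCon.mkₐ_surjective

theorem nicholsProj_eq_zero_iff {x : TensorAlgebra K V} : c.nicholsProj x = 0 ↔ c.gamma x = 0 := by
  rw [← mem_nicholsIdeal, TwoSidedIdeal.mem_iff]
  exact Quotient.eq''

/-- The degree `n` component of the Nichols algebra: the image of `V^{⊗ n}`. -/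
noncomputable def nicholsGrading (n : ℕ) : Submodule K c.NicholsAlgebra :=
  (degPart K V n).map c.nicholsProj.toLinearMap

theorem nicholsProj_mem {n : ℕ} {x : TensorAlgebra K V} (hx : x ∈ degPart K V n) :
    c.nicholsProj x ∈ c.nicholsGrading n := ⟨x, hx, rfl⟩

instance : SetLike.GradedMonoid c.nicholsGrading where
  one_mem := ⟨1, one_mem_degPart, map_one c.nicholsProj⟩
  mul_mem := by
    rintro m n _ _ ⟨x, hx, rfl⟩ ⟨y, hy, rfl⟩
    exact ⟨x * y, mul_mem_degPart hx hy, map_mul c.nicholsProj x y⟩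

theorem degProj_zero_comp_shuffle : degProj K V 0 ∘ₗ c.shuffle = 0 := by
  have h : ∀ v x, degProj K V 0 (c.shuffle (v ⊗ₜ x)) = 0 := by
    intro v x
    induction x using left_induction with
    | one => rw [shuffle_one, ← mul_one (ι K v), degProj_zero_ι_mul]
    | add x y hx hy => simp only [map_add, tmul_add, hx, hy, add_zero]
    | smul k x hx => simp only [map_smul, tmul_smul, hx, smul_zero]
    | ι_mul w x =>
      rw [shuffle_ι_mul, map_add, degProj_zero_ι_mul, ← LinearMap.comp_apply (degProj K V 0),
        degProj_comp_lmul_zero]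
      simp
  exact TensorProduct.ext' h

theorem degProj_succ_shuffle (n : ℕ) (v : V) (x : TensorAlgebra K V) :
    degProj K V (n + 1) (c.shuffle (v ⊗ₜ x)) = c.shuffle (v ⊗ₜ degProj K V n x) := by
  induction x using left_induction generalizing v n with
  | one =>
    have h : degProj K V (n + 1) (ι K v) = ι K v * degProj K V n 1 := by
      rw [← degProj_succ_ι_mul, mul_one]
    rw [shuffle_one, h]
    cases n <;> simp
  | add x y hx hy => simp only [map_add, tmul_add, hx, hy]
  | smul k x hx => simp only [map_smul, tmul_smul, hx]
  | ι_mul u x ih =>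
    rw [shuffle_ι_mul, map_add, degProj_succ_ι_mul, ← LinearMap.comp_apply (degProj K V (n + 1)),
      degProj_comp_lmul_succ, LinearMap.comp_apply, lTensor_comp_apply]
    cases n with
    | zero =>
      simp [degProj_zero_comp_shuffle]
    | succ n =>
      rw [degProj_succ_ι_mul, shuffle_ι_mul]
      congr 2
      exact c.lTensor_head_apply_congr (by simpa using fun v => ih n v) v u

theorem gamma_degProj (n : ℕ) (x : TensorAlgebra K V) :
    degProj K V n (c.gamma x) = c.gamma (degProj K V n x) := by
  induction x using left_induction generalizing n with
  | one => cases n <;> simp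
  | add x y hx hy => simp only [map_add, hx, hy]
  | smul k x hx => simp only [map_smul, hx]
  | ι_mul v x ih =>
    cases n with
    | zero =>
      rw [gamma_ι_mul, degProj_zero_ι_mul, ← LinearMap.comp_apply (degProj K V 0),
        degProj_zero_comp_shuffle, map_zero, LinearMap.zero_apply]
    | succ n => rw [gamma_ι_mul, degProj_succ_shuffle, ih, degProj_succ_ι_mul, gamma_ι_mul]

/-- The canonical map from `V` to the degree one component of the Nichols algebra. -/
noncomputable def nicholsι : V →ₗ[K] c.nicholsGrading 1 :=
  LinearMap.codRestrict (c.nicholsGrading 1) (c.nicholsProj.toLinearMap ∘ₗ ι K)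
    fun v => ⟨ι K v, ι_mem_degPart v, rfl⟩

theorem coe_nicholsι (v : V) : (c.nicholsι v : c.NicholsAlgebra) = c.nicholsProj (ι K v) := rfl

/-- The decomposition of elements of the Nichols algebra into homogeneous components, on
representatives. -/
noncomputable def nicholsDecompose :
    TensorAlgebra K V →ₐ[K] DirectSum ℕ fun n => c.nicholsGrading n :=
  TensorAlgebra.lift K (DirectSum.lof K ℕ (fun n => c.nicholsGrading n) 1 ∘ₗ c.nicholsι)

theorem nicholsDecompose_ι (v : V) : c.nicholsDecompose (ι K v) =
    DirectSum.of (fun n => c.nicholsGrading n) 1 (c.nicholsι v) := by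
  simp [nicholsDecompose, DirectSum.lof_eq_of]

theorem nicholsDecompose_apply (x : TensorAlgebra K V) (n : ℕ) :
    (c.nicholsDecompose x n : c.NicholsAlgebra) = c.nicholsProj (degProj K V n x) := by
  induction x using left_induction generalizing n with
  | one =>
    rw [map_one]
    cases n with
    | zero => simp [DirectSum.one_def]
    | succ n =>
      rw [DirectSum.one_def, DirectSum.of_eq_of_ne _ _ _ (by simp)]
      simp
  | add x y hx hy => simp only [map_add, DirectSum.add_apply, Submodule.coe_add, hx, hy]
  | smul k x hx => simp only [map_smul, DirectSum.smul_apply, Submodule.coe_smul, hx]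
  | ι_mul v x ih =>
    rw [map_mul, nicholsDecompose_ι]
    cases n with
    | zero =>
      refine (DirectSum.coe_of_mul_apply_of_not_le c.nicholsGrading (c.nicholsι v)
        (c.nicholsDecompose x) 0 (by simp)).trans ?_
      simp
    | succ n =>
      rw [add_comm n 1, DirectSum.coe_of_mul_apply_add, add_comm 1 n, degProj_succ_ι_mul, map_mul,
        ← ih, coe_nicholsι]

/-- The Nichols algebra is graded by the images of the tensor powers of `V`. -/
noncomputable instance : GradedAlgebra c.nicholsGrading :=
  GradedAlgebra.ofAlgHom _
    (c.nicholsIdeal.ringCon.liftₐ c.nicholsDecompose (by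
      intro x y h
      change c.nicholsDecompose x = c.nicholsDecompose y
      rw [TwoSidedIdeal.rel_iff, mem_nicholsIdeal] at h
      ext n
      rw [nicholsDecompose_apply, nicholsDecompose_apply, ← sub_eq_zero, ← map_sub, ← map_sub,
        c.nicholsProj_eq_zero_iff, ← gamma_degProj, h, map_zero]))
    (by
      apply RingCon.Quotient.hom_extₐ
      ext v
      change DirectSum.coeAlgHom c.nicholsGrading (c.nicholsDecompose (ι K v)) =
        c.nicholsProj (ι K v)
      rw [nicholsDecompose_ι, DirectSum.coeAlgHom_of, coe_nicholsι])
    (by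
      rintro i ⟨_, x, hx, rfl⟩
      change c.nicholsDecompose x = _
      ext n
      rw [nicholsDecompose_apply]
      by_cases h : i = n
      · subst h
        rw [degProj_of_mem hx]
        simp
      · rw [degProj_of_mem_ne h hx, DirectSum.of_eq_of_ne _ _ _ (Ne.symm h)]
        simp)

end Braiding

/-- A graded algebra `A = ⨁ A^n`, with homogeneous components `A^n = 𝒜 n`, is a quadratic algebra
if `A^0 = K`, the natural map `π : T(A^1) → A` is surjective, and the kernel of `π` is generated,
as a two-sided ideal, by its elements of degree two. -/
structure IsQuadraticAlgebra (K : Type*) [Field K] {A : Type*} [Ring A] [Algebra K A]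
    (𝒜 : ℕ → Submodule K A) [GradedAlgebra 𝒜] : Prop where
  algebraMap_injective : Function.Injective (algebraMap K A)
  zero_eq : 𝒜 0 = LinearMap.range (Algebra.linearMap K A)
  surjective : Function.Surjective (TensorAlgebra.lift K (𝒜 1).subtype)
  ker_eq : TwoSidedIdeal.ker (TensorAlgebra.lift K (𝒜 1).subtype) =
    TwoSidedIdeal.span {x | x ∈ degPart K (𝒜 1) 2 ∧ TensorAlgebra.lift K (𝒜 1).subtype x = 0}

end

section

open scoped TensorProduct
open TensorAlgebra TensorProduct

variable {K : Type*} [Field K] {V : Type*} [AddCommGroup V] [Module K V]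

/-! ### Ideals and homogeneous components of the tensor algebra -/

namespace TensorAlgebra

/-! Write I for the enveloping ideal of b and J for the quadratic one, with β the restriction of b
to E₂. Since E₂ lies in E, J is contained in I. The reverse inclusion is a comparison of leading
terms (top homogeneous components), resting on three facts.

(1) I is a coideal, stable under braiding with V. Elements of E are primitive (`comul_of_mem_E`), so
the generators z - b(z) are primitive too. The two bracket identities say exactly that c_T moves
these generators past V modulo I (`rTensor_projU_braidVT`, `lTensor_projU_braidWith`). Since Δ is
multiplicative for the braided product, Δ(I) then lies in I ⊗ T + T ⊗ I (`map_projU_comul`).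

(2) The leading term of every element of I is killed by Γ
(`IsBraidedLieAlgebra.gamma_degProj_eq_zero`). As V embeds in U, each linear form φ on V extends to
a form f on T vanishing on I and at 1. By (1) the operator (f ⊗ id)Δ maps I to I. It lowers degree,
and on a leading term x of degree n+1 its degree n part is (φ ⊗ id)Δ^{1,n}(x). By induction on the
degree Γ kills these elements for all φ, so (id ⊗ Γ)Δ^{1,n}(x) = 0. The quantum symmetrizer factors
through Δ^{1,n} (`gamma_eq_lmul_deriv`), so Γ(x) = 0.

(3) If the Nichols algebra is quadratic, ker Γ is generated by its degree two part
(`mem_span_of_gamma_eq_zero`), which is E₂ because Γ = id + c on V ⊗ V. Replacing each z in E₂ by z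
- β(z) shows that every homogeneous element of that ideal is the leading term of some element of J
(`exists_mem_quadEnvelopingIdeal`).

Hence a leading term of an element of I can always be cancelled by an element of J, itself in I, and
induction on the degree gives I = J.

The quadratic Lie structure does not use quadraticity of the Nichols algebra. The bracket identities
restrict from E to E₂. For t in (E₂ ⊗ V) ∩ (V ⊗ E₂), both (β ⊗ V)t and (V ⊗ β)t have the same image
in U as t. Their difference d lies in E₂ and vanishes in U, and so does β(d), since d and β(d) agree
in U; injectivity of V → U gives β(d) = 0. -/

/-- A subspace of the tensor algebra which is stable under left and right multiplication by elements
of `V` and contains `s` contains the two-sided ideal generated by `s`. -/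
theorem mem_of_mem_span (S : Submodule K (TensorAlgebra K V)) {s : Set (TensorAlgebra K V)}
    (subset : ∀ x ∈ s, x ∈ S) (ι_mul : ∀ v, ∀ x ∈ S, ι K v * x ∈ S)
    (mul_ι : ∀ v, ∀ x ∈ S, x * ι K v ∈ S) {x : TensorAlgebra K V}
    (hx : x ∈ TwoSidedIdeal.span s) : x ∈ S := by
  have hl : ∀ a, ∀ y ∈ S, a * y ∈ S := by
    intro a
    induction a using TensorAlgebra.induction with
    | algebraMap r => intro y hy; rw [← Algebra.smul_def]; exact S.smul_mem r hy
    | ι v => exact ι_mul v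
    | mul a b ha hb => intro y hy; rw [mul_assoc]; exact ha _ (hb _ hy)
    | add a b ha hb => intro y hy; rw [add_mul]; exact S.add_mem (ha _ hy) (hb _ hy)
  have hr : ∀ a, ∀ y ∈ S, y * a ∈ S := by
    intro a
    induction a using TensorAlgebra.induction with
    | algebraMap r =>
      intro y hy; rw [← Algebra.commutes, ← Algebra.smul_def]; exact S.smul_mem r hy
    | ι v => exact mul_ι v
    | mul a b ha hb => intro y hy; rw [← mul_assoc]; exact hb _ (ha _ hy)
    | add a b ha hb => intro y hy; rw [mul_add]; exact S.add_mem (ha _ hy) (hb _ hy)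
  have h := TwoSidedIdeal.mem_span_iff.mp hx
    (TwoSidedIdeal.mk' (S : Set (TensorAlgebra K V)) S.zero_mem S.add_mem S.neg_mem
      (hl _ _) (hr _ _)) fun y hy => by simpa using subset y hy
  simpa using h

theorem exists_degProj_eq_zero (x : TensorAlgebra K V) : ∃ n, ∀ k > n, degProj K V k x = 0 := by
  induction x using left_induction with
  | one => exact ⟨0, fun k hk => by obtain ⟨k, rfl⟩ := Nat.exists_eq_succ_of_ne_zero hk.ne'; simp⟩
  | add x y hx hy =>
    obtain ⟨n, hn⟩ := hx
    obtain ⟨m, hm⟩ := hy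
    exact ⟨max n m, fun k hk => by rw [map_add, hn k (by omega), hm k (by omega), add_zero]⟩
  | smul r x hx =>
    obtain ⟨n, hn⟩ := hx
    exact ⟨n, fun k hk => by rw [map_smul, hn k hk, smul_zero]⟩
  | ι_mul v x hx =>
    obtain ⟨n, hn⟩ := hx
    refine ⟨n + 1, fun k hk => ?_⟩
    obtain ⟨k, rfl⟩ := Nat.exists_eq_succ_of_ne_zero (by omega : k ≠ 0)
    rw [Nat.succ_eq_add_one, degProj_succ_ι_mul, hn k (by omega), mul_zero]

theorem sum_degProj {n : ℕ} {x : TensorAlgebra K V} (hx : ∀ k > n, degProj K V k x = 0) :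
    ∑ k ∈ Finset.range (n + 1), degProj K V k x = x := by
  classical
  have h := DirectSum.sum_support_decompose
    (fun n : ℕ => LinearMap.range (ι K : V →ₗ[K] TensorAlgebra K V) ^ n) x
  conv_rhs => rw [← h]
  symm
  apply Finset.sum_subset
  · intro k hk
    by_contra hkn
    have : degProj K V k x = 0 := hx k (by simp at hkn; omega)
    rw [DFinsupp.mem_support_iff] at hk
    exact hk (Subtype.ext this)
  · intro k _ hk
    rw [DFinsupp.notMem_support_iff] at hk
    exact congrArg Subtype.val hk

theorem eq_zero_of_degProj {x : TensorAlgebra K V} (hx : ∀ k, degProj K V k x = 0) : x = 0 := by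
  rw [← sum_degProj (n := 0) (x := x) fun k _ => hx k]
  simp [hx]

theorem degProj_degProj (n : ℕ) (x : TensorAlgebra K V) :
    degProj K V n (degProj K V n x) = degProj K V n x :=
  degProj_of_mem (degProj_mem n x)

theorem degProj_degProj_of_ne {n m : ℕ} (h : n ≠ m) (x : TensorAlgebra K V) :
    degProj K V m (degProj K V n x) = 0 :=
  degProj_of_mem_ne h (degProj_mem n x)

theorem degProj_zero_mul_ι (x : TensorAlgebra K V) (v : V) : degProj K V 0 (x * ι K v) = 0 :=
  DirectSum.coe_decompose_mul_of_right_mem_of_not_le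
    (fun n : ℕ => LinearMap.range (ι K : V →ₗ[K] TensorAlgebra K V) ^ n)
    (ι_mem_degPart v) (by simp)

theorem degProj_succ_mul_ι (n : ℕ) (x : TensorAlgebra K V) (v : V) :
    degProj K V (n + 1) (x * ι K v) = degProj K V n x * ι K v :=
  DirectSum.coe_decompose_mul_add_of_right_mem
    (fun n : ℕ => LinearMap.range (ι K : V →ₗ[K] TensorAlgebra K V) ^ n) (ι_mem_degPart v)

theorem degProj_zero_eq (x : TensorAlgebra K V) :
    degProj K V 0 x = algebraMap K _ (algebraMapInv x) := by
  induction x using left_induction with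
  | one => simp
  | add x y hx hy => simp [hx, hy]
  | smul k x hx => rw [map_smul, map_smul, hx, smul_eq_mul, map_mul, Algebra.smul_def]
  | ι_mul v x hx => simp [algebraMapInv]

/-- A tensor is the finite sum of its bihomogeneous components, so identities in T ⊗ T can be
checked one bidegree at a time. -/
theorem eq_zero_of_map_degProj {t : TensorAlgebra K V ⊗[K] TensorAlgebra K V}
    (h : ∀ p q, TensorProduct.map (degProj K V p) (degProj K V q) t = 0) : t = 0 := by
  have key : ∃ n, ∑ p ∈ Finset.range n, ∑ q ∈ Finset.range n,
      TensorProduct.map (degProj K V p) (degProj K V q) t = t := by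
    -- Two summands of t come with different bounds; asking for all larger m lets both be used at
    -- their maximum.
    have key' : ∃ n, ∀ m ≥ n, ∑ p ∈ Finset.range m, ∑ q ∈ Finset.range m,
        TensorProduct.map (degProj K V p) (degProj K V q) t = t := by
      clear h
      induction t with
      | zero => exact ⟨0, by simp⟩
      | add a b ha hb =>
        obtain ⟨n, hn⟩ := ha
        obtain ⟨m, hm⟩ := hb
        refine ⟨max n m, fun k hk => ?_⟩
        simp only [map_add, Finset.sum_add_distrib]
        rw [hn k (by omega), hm k (by omega)]
      | tmul x y =>
        obtain ⟨n, hn⟩ := exists_degProj_eq_zero x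
        obtain ⟨m, hm⟩ := exists_degProj_eq_zero y
        refine ⟨max n m + 1, fun k hk => ?_⟩
        obtain ⟨k, rfl⟩ := Nat.exists_eq_succ_of_ne_zero (by omega : k ≠ 0)
        simp only [map_tmul, ← tmul_sum, ← sum_tmul]
        rw [Nat.succ_eq_add_one, sum_degProj fun j hj => hn j (by omega),
          sum_degProj fun j hj => hm j (by omega)]
    exact ⟨key'.choose, key'.choose_spec _ le_rfl⟩
  obtain ⟨n, hn⟩ := key
  rw [← hn]
  simp [h]

end TensorAlgebra

namespace Braiding

variable (c : Braiding K V)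
/-! ### Degrees in the comultiplication -/

theorem lmulSnd_tmul (v : V) (x y : TensorAlgebra K V) :
    c.lmulSnd (v ⊗ₜ (x ⊗ₜ y)) =
      (lmul K V).lTensor _ (TensorProduct.assoc K _ V _ (c.braidVT (v ⊗ₜ x) ⊗ₜ y)) := by
  simp [lmulSnd]

theorem lmulSnd_one_tmul (v : V) (y : TensorAlgebra K V) :
    c.lmulSnd (v ⊗ₜ (1 ⊗ₜ y)) = 1 ⊗ₜ (ι K v * y) := by
  simp [lmulSnd_tmul]

theorem lTensor_degProj_succ_lmulSnd (n : ℕ) (v : V)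
    (z : TensorAlgebra K V ⊗[K] TensorAlgebra K V) :
    (degProj K V (n + 1)).lTensor _ (c.lmulSnd (v ⊗ₜ z)) =
      c.lmulSnd (v ⊗ₜ (degProj K V n).lTensor _ z) := by
  induction z with
  | zero => simp
  | add a b ha hb => simp only [tmul_add, map_add, ha, hb]
  | tmul x y =>
    rw [LinearMap.lTensor_tmul, lmulSnd_tmul, lmulSnd_tmul]
    generalize c.braidVT (v ⊗ₜ x) = t
    induction t with
    | zero => simp
    | add a b ha hb => simp only [add_tmul, map_add, ha, hb]
    | tmul a b => simp

theorem lTensor_degProj_zero_lmulSnd (v : V)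
    (z : TensorAlgebra K V ⊗[K] TensorAlgebra K V) :
    (degProj K V 0).lTensor _ (c.lmulSnd (v ⊗ₜ z)) = 0 := by
  induction z with
  | zero => simp
  | add a b ha hb => simp only [tmul_add, map_add, ha, hb, add_zero]
  | tmul x y =>
    rw [lmulSnd_tmul]
    generalize c.braidVT (v ⊗ₜ x) = t
    induction t with
    | zero => simp
    | add a b ha hb => simp only [add_tmul, map_add, ha, hb, add_zero]
    | tmul a b => simp

/-- The letter v crosses the first factor by the braiding, which preserves degree, and is absorbed
by the second factor. -/
theorem rTensor_degProj_lmulSnd (n : ℕ) (v : V)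
    (z : TensorAlgebra K V ⊗[K] TensorAlgebra K V) :
    (degProj K V n).rTensor _ (c.lmulSnd (v ⊗ₜ z)) =
      c.lmulSnd (v ⊗ₜ (degProj K V n).rTensor _ z) := by
  induction z with
  | zero => simp
  | add a b ha hb => simp only [tmul_add, map_add, ha, hb]
  | tmul x y =>
    rw [LinearMap.rTensor_tmul, lmulSnd_tmul, lmulSnd_tmul, ← braidVT_degProj]
    generalize c.braidVT (v ⊗ₜ x) = t
    induction t with
    | zero => simp
    | add a b ha hb => simp only [add_tmul, map_add, ha, hb]
    | tmul a b => simp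

/-- The counit axiom, with the degree zero projection as counit: multiplying by v ⊗ 1 creates
positive degree on the left, so only the factors 1 ⊗ v survive. -/
theorem rTensor_degProj_zero_comul (x : TensorAlgebra K V) :
    (degProj K V 0).rTensor _ (c.comul x) = 1 ⊗ₜ x := by
  induction x using left_induction with
  | one => simp
  | add x y hx hy => simp only [map_add, tmul_add, hx, hy]
  | smul k x hx => simp only [map_smul, tmul_smul, hx]
  | ι_mul v x ih =>
    rw [comul_ι_mul, map_add, rTensor_degProj_zero_lmulTensor, zero_add, rTensor_degProj_lmulSnd,
      ih, lmulSnd_one_tmul]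

theorem lTensor_degProj_zero_comul (x : TensorAlgebra K V) :
    (degProj K V 0).lTensor _ (c.comul x) = x ⊗ₜ 1 := by
  induction x using left_induction with
  | one => simp
  | add x y hx hy => simp only [map_add, add_tmul, hx, hy]
  | smul k x hx => simp only [map_smul, smul_tmul', hx]
  | ι_mul v x ih =>
    rw [comul_ι_mul, map_add, lTensor_degProj_zero_lmulSnd, add_zero, lTensor_comp_lmulTensor,
      LinearMap.lTensor_tmul, ih, lmulTensor_tmul]

theorem comulPart_apply (p q : ℕ) (x : TensorAlgebra K V) :
    c.comulPart p q x = (degProj K V p).rTensor _ ((degProj K V q).lTensor _ (c.comul x)) := by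
  rw [← LinearMap.comp_apply, LinearMap.rTensor_comp_lTensor, comulPart, LinearMap.comp_apply]

/-- Δ is graded: multiplication by v ⊗ 1 raises the first degree by one, multiplication by 1 ⊗ v the
second, and neither changes the other degree. -/
theorem comulPart_degProj_of_ne {p q n : ℕ} (h : p + q ≠ n) (x : TensorAlgebra K V) :
    c.comulPart p q (degProj K V n x) = 0 := by
  induction x using left_induction generalizing p q n with
  | one =>
    cases n with
    | succ n => simp
    | zero =>
      rw [degProj_zero_one, comulPart, LinearMap.comp_apply, comul_one, map_tmul]
      rcases Nat.eq_zero_or_pos p with rfl | hp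
      · obtain ⟨q, rfl⟩ := Nat.exists_eq_succ_of_ne_zero (by omega : q ≠ 0)
        simp
      · obtain ⟨p, rfl⟩ := Nat.exists_eq_succ_of_ne_zero (by omega : p ≠ 0)
        simp
  | add x y hx hy => simp only [map_add, hx h, hy h, add_zero]
  | smul k x hx => simp only [map_smul, hx h, smul_zero]
  | ι_mul v x ih =>
    cases n with
    | zero => simp
    | succ n =>
      rw [degProj_succ_ι_mul, comulPart_apply, comul_ι_mul, map_add, map_add,
        lTensor_comp_lmulTensor]
      have e₁ : (degProj K V p).rTensor _ (lmulTensor K V _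
          (((degProj K V q).lTensor _).lTensor V (v ⊗ₜ c.comul (degProj K V n x)))) = 0 := by
        cases p with
        | zero => rw [rTensor_degProj_zero_lmulTensor]
        | succ p =>
          rw [rTensor_degProj_lmulTensor, LinearMap.lTensor_tmul, LinearMap.lTensor_tmul,
            ← comulPart_apply, ih (by omega), tmul_zero, map_zero]
      have e₂ : (degProj K V p).rTensor _ ((degProj K V q).lTensor _
          (c.lmulSnd (v ⊗ₜ c.comul (degProj K V n x)))) = 0 := by
        cases q with
        | zero => rw [lTensor_degProj_zero_lmulSnd, map_zero]
        | succ q =>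
          rw [lTensor_degProj_succ_lmulSnd, rTensor_degProj_lmulSnd, ← comulPart_apply,
            ih (by omega), tmul_zero, map_zero]
      rw [e₁, e₂, add_zero]

theorem comul_ι (v : V) : c.comul (ι K v) = ι K v ⊗ₜ 1 + 1 ⊗ₜ ι K v := by
  rw [← mul_one (ι K v), comul_ι_mul]; simp [lmulSnd]

/-- The elements of `E(V, c)` are primitive. -/
theorem comul_of_mem_E {z : TensorAlgebra K V} (hz : z ∈ c.E) :
    c.comul z = z ⊗ₜ 1 + 1 ⊗ₜ z := by
  induction hz using Submodule.iSup_induction' with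
  | zero => simp
  | add x y _ _ hx hy => rw [map_add, hx, hy, add_tmul, tmul_add]; abel
  | mem n x hx =>
    by_cases hn : n ≤ 1
    · rw [En, if_pos hn] at hx
      simp [(Submodule.mem_bot K).mp hx]
    rw [mem_En_iff _ (by omega)] at hx
    obtain ⟨hd, hp⟩ := hx
    rw [← sub_eq_zero]
    apply eq_zero_of_map_degProj
    intro p q
    have e : TensorProduct.map (degProj K V p) (degProj K V q) (c.comul x) =
      c.comulPart p q x := rfl
    have hne : ∀ k, k ≠ n → degProj K V k x = 0 := fun k hk => by
      rw [← hd, degProj_degProj_of_ne hk.symm]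
    rw [map_sub, map_add, map_tmul, map_tmul, e]
    -- Bidegree (0,0) is empty because n ≥ 2. If exactly one index is zero, the counit axioms give
    -- the component. If both are positive, it vanishes by definition of E_n when p + q = n, and by
    -- gradedness otherwise.
    rcases p with _ | p <;> rcases q with _ | q
    · rw [hne 0 (by omega), ← hd, comulPart_degProj_of_ne _ (by omega)]
      simp
    · rw [comulPart, LinearMap.comp_apply, ← LinearMap.lTensor_comp_rTensor, LinearMap.comp_apply,
        rTensor_degProj_zero_comul]
      simp
    · rw [comulPart_apply, lTensor_degProj_zero_comul]
      simp
    · rw [degProj_succ_one, degProj_succ_one, tmul_zero, zero_tmul, add_zero, sub_zero]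
      by_cases h : p + 1 + (q + 1) = n
      · exact hp _ _ (by omega) (by omega) h
      · rw [← hd, comulPart_degProj_of_ne _ h]

end Braiding

namespace Braiding

variable (c : Braiding K V)
variable {X : Type*} [AddCommGroup X] [Module K X]

/-! ### Multiplicativity of the braiding and of the comultiplication -/

/-- `x ⊗ v ↦ (x ⊗ 1) c_{V, T(V)} (v ⊗ y)`. -/
noncomputable def mulBraid (y : TensorAlgebra K V) :
    TensorAlgebra K V ⊗[K] V →ₗ[K] TensorAlgebra K V ⊗[K] V :=
  (LinearMap.mul' K (TensorAlgebra K V)).rTensor V ∘ₗ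
    (TensorProduct.assoc K _ _ V).symm.toLinearMap ∘ₗ
    (c.braidVT ∘ₗ (TensorProduct.mk K V _).flip y).lTensor _

theorem mulBraid_tmul (y x : TensorAlgebra K V) (v : V) :
    c.mulBraid y (x ⊗ₜ v) = (LinearMap.mulLeft K x).rTensor V (c.braidVT (v ⊗ₜ y)) := by
  simp only [mulBraid, LinearMap.comp_apply, LinearMap.lTensor_tmul, LinearMap.flip_apply, mk_apply]
  generalize c.braidVT (v ⊗ₜ y) = t
  induction t with
  | zero => simp
  | add a b ha hb => simp only [tmul_add, map_add, ha, hb]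
  | tmul a b => simp

theorem mulBraid_lmulTensor (y : TensorAlgebra K V) (z : V ⊗[K] (TensorAlgebra K V ⊗[K] V)) :
    c.mulBraid y (lmulTensor K V V z) = lmulTensor K V V ((c.mulBraid y).lTensor V z) := by
  rw [← LinearMap.comp_apply, ← LinearMap.comp_apply (lmulTensor K V V)]
  congr 1
  ext u x v
  simp only [AlgebraTensorModule.curry_apply, curry_apply, LinearMap.coe_restrictScalars,
    LinearMap.comp_apply, LinearMap.lTensor_tmul, lmulTensor_tmul, mulBraid_tmul]
  generalize c.braidVT (v ⊗ₜ y) = t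
  induction t with
  | zero => simp
  | add a b ha hb => simp only [tmul_add, map_add, ha, hb]
  | tmul a b => simp

/-- One hexagon axiom: crossing x * y means crossing x, then y. The recursion defining `braidVT` is
the case where x is a letter; taking y to be a letter gives the control over right multiplication
needed for two-sided ideals. -/
theorem braidVT_mul (v : V) (x y : TensorAlgebra K V) :
    c.braidVT (v ⊗ₜ (x * y)) = c.mulBraid y (c.braidVT (v ⊗ₜ x)) := by
  induction x using left_induction generalizing v with
  | one => rw [one_mul, braidVT_one, mulBraid_tmul]; simp [LinearMap.mulLeft_one]
  | add x₁ x₂ h₁ h₂ => simp only [add_mul, tmul_add, map_add, h₁, h₂]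
  | smul k x hx => simp only [smul_mul_assoc, tmul_smul, map_smul, hx]
  | ι_mul u x ih =>
    rw [mul_assoc, braidVT_ι_mul, braidVT_ι_mul, mulBraid_lmulTensor, lTensor_comp_apply]
    congr 1
    exact c.lTensor_head_apply_congr (by simpa using ih) v u

theorem braidVT_ι (v w : V) :
    c.braidVT (v ⊗ₜ ι K w) = (ι K).rTensor V (c.c (v ⊗ₜ w)) := by
  rw [← mul_one (ι K w), braidVT_ι_mul, head_tmul]
  generalize c.c (v ⊗ₜ w) = t
  induction t with
  | zero => simp
  | add a b ha hb => simp only [map_add, add_tmul, ha, hb]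
  | tmul a b => simp

theorem braidWith_ι (w v : V) :
    c.braidWith w (ι K v) = (ι K).lTensor V (c.c (v ⊗ₜ w)) := by
  rw [← mul_one (ι K v), braidWith_ι_mul, braidWith_one, head_tmul]
  generalize c.c (v ⊗ₜ w) = t
  induction t with
  | zero => simp
  | add a b ha hb => simp only [map_add, add_tmul, ha, hb]
  | tmul a b => simp

/-- `x ⊗ (v ⊗ y) ↦ c_{T(V), V} (x ⊗ v) (1 ⊗ y)`. -/
noncomputable def braidMul : TensorAlgebra K V ⊗[K] (V ⊗[K] TensorAlgebra K V) →ₗ[K]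
    V ⊗[K] TensorAlgebra K V :=
  (LinearMap.mul' K (TensorAlgebra K V)).lTensor V ∘ₗ
    (TensorProduct.assoc K V _ _).toLinearMap ∘ₗ c.braidTV.rTensor _ ∘ₗ
    (TensorProduct.assoc K _ V _).symm.toLinearMap

theorem braidMul_tmul (x y : TensorAlgebra K V) (v : V) :
    c.braidMul (x ⊗ₜ (v ⊗ₜ y)) = (LinearMap.mulRight K y).lTensor V (c.braidWith v x) := by
  simp only [braidMul, LinearMap.comp_apply, LinearEquiv.coe_coe, assoc_symm_tmul,
    LinearMap.rTensor_tmul, ← braidWith_apply]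
  generalize c.braidWith v x = t
  induction t with
  | zero => simp
  | add a b ha hb => simp only [add_tmul, map_add, ha, hb]
  | tmul a b => simp

theorem braidMul_ι_mul (u : V) (x : TensorAlgebra K V) (z : V ⊗[K] TensorAlgebra K V) :
    c.braidMul ((ι K u * x) ⊗ₜ z) =
      (lmul K V).lTensor V (c.head _ (u ⊗ₜ c.braidMul (x ⊗ₜ z))) := by
  induction z with
  | zero => simp
  | add a b ha hb => simp only [tmul_add, map_add, ha, hb]
  | tmul v y =>
    rw [braidMul_tmul, braidMul_tmul, braidWith_ι_mul, lTensor_comp_apply]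
    have e : LinearMap.mulRight K y ∘ₗ lmul K V =
        lmul K V ∘ₗ (LinearMap.mulRight K y).lTensor V := by
      ext a b; simp [mul_assoc]
    rw [e, LinearMap.lTensor_comp, LinearMap.comp_apply, head_naturality, LinearMap.lTensor_tmul]

/-- The other hexagon axiom: w coming from the right crosses y first, and what emerges crosses x. -/
theorem braidWith_mul (w : V) (x y : TensorAlgebra K V) :
    c.braidWith w (x * y) = c.braidMul (x ⊗ₜ c.braidWith w y) := by
  induction x using left_induction with
  | one =>
    rw [one_mul]
    generalize c.braidWith w y = t
    induction t with
    | zero => simp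
    | add a b ha hb => simp only [tmul_add, map_add, ← ha, ← hb]
    | tmul a b => rw [braidMul_tmul, braidWith_one]; simp
  | add x₁ x₂ h₁ h₂ => simp only [add_mul, add_tmul, map_add, h₁, h₂]
  | smul k x hx => simp only [smul_mul_assoc, ← smul_tmul', map_smul, hx]
  | ι_mul u x ih => rw [mul_assoc, braidWith_ι_mul, ih, braidMul_ι_mul]

/-- Right multiplication by `w ⊗ 1` in the braided tensor product algebra `T(V) ⊗ T(V)`. -/
noncomputable def rmulFst (w : V) : TensorAlgebra K V ⊗[K] TensorAlgebra K V →ₗ[K]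
    TensorAlgebra K V ⊗[K] TensorAlgebra K V :=
  (LinearMap.mul' K (TensorAlgebra K V) ∘ₗ (ι K).lTensor _).rTensor _ ∘ₗ
    (TensorProduct.assoc K _ V _).symm.toLinearMap ∘ₗ (c.braidWith w).lTensor _

/-- `x ⊗ (v ⊗ y) ↦ x * v ⊗ y`. -/
noncomputable def shiftMul : TensorAlgebra K V ⊗[K] (V ⊗[K] TensorAlgebra K V) →ₗ[K]
    TensorAlgebra K V ⊗[K] TensorAlgebra K V :=
  (LinearMap.mul' K (TensorAlgebra K V) ∘ₗ (ι K).lTensor _).rTensor _ ∘ₗ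
    (TensorProduct.assoc K _ V _).symm.toLinearMap

theorem shiftMul_tmul (x y : TensorAlgebra K V) (v : V) :
    shiftMul (x ⊗ₜ (v ⊗ₜ y)) = (x * ι K v) ⊗ₜ y := by
  simp [shiftMul]

theorem rmulFst_tmul (w : V) (x y : TensorAlgebra K V) :
    c.rmulFst w (x ⊗ₜ y) = shiftMul (x ⊗ₜ c.braidWith w y) := rfl

theorem rmulFst_lmulTensor (w : V) (z : V ⊗[K] (TensorAlgebra K V ⊗[K] TensorAlgebra K V)) :
    c.rmulFst w (lmulTensor K V _ z) = lmulTensor K V _ ((c.rmulFst w).lTensor V z) := by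
  rw [← LinearMap.comp_apply, ← LinearMap.comp_apply (lmulTensor K V _)]
  congr 1
  ext u x y
  simp only [AlgebraTensorModule.curry_apply, curry_apply, LinearMap.coe_restrictScalars,
    LinearMap.comp_apply, LinearMap.lTensor_tmul, lmulTensor_tmul, rmulFst_tmul]
  generalize c.braidWith w y = t
  induction t with
  | zero => simp
  | add a b ha hb => simp only [tmul_add, map_add, ha, hb]
  | tmul a b => simp [shiftMul_tmul, mul_assoc]

/-- The nontrivial case of associativity in the braided tensor square, (1 ⊗ v)(z(w ⊗ 1)) = ((1 ⊗
v)z)(w ⊗ 1). For z = x ⊗ y, in either order v crosses x, w crosses y, and the two outcomes are then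
braided by c, so the hexagon axioms suffice. -/
theorem rmulFst_lmulSnd (w v : V) (z : TensorAlgebra K V ⊗[K] TensorAlgebra K V) :
    c.rmulFst w (c.lmulSnd (v ⊗ₜ z)) = c.lmulSnd (v ⊗ₜ c.rmulFst w z) := by
  induction z with
  | zero => simp
  | add a b ha hb => simp only [tmul_add, map_add, ha, hb]
  | tmul x y =>
    rw [rmulFst_tmul, lmulSnd_tmul]
    -- The outcome s of braiding w past y is given its own name, so that both sides become linear in
    -- s and s can afterwards be split into pure tensors.
    have e : ∀ (t : TensorAlgebra K V ⊗[K] V) (s : V ⊗[K] TensorAlgebra K V)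
        (_ : s = c.braidWith w y),
        c.rmulFst w ((lmul K V).lTensor _ (TensorProduct.assoc K _ V _ (t ⊗ₜ y))) =
          shiftMul (((lmul K V).lTensor V ∘ₗ c.head _ ∘ₗ
            (TensorProduct.mk K V _).flip s).lTensor _ t) := by
      rintro t s rfl
      induction t with
      | zero => simp
      | add a b ha hb => simp only [add_tmul, map_add, ha, hb]
      | tmul a b => simp [rmulFst_tmul, braidWith_ι_mul]
    rw [e _ _ rfl]
    generalize c.braidWith w y = s
    induction s with
    | zero => simp
    | add a b ha hb =>
      simp only [tmul_add, map_add, ← ha, ← hb, LinearMap.comp_add, LinearMap.lTensor_add,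
        LinearMap.add_apply]
    | tmul p q =>
      rw [shiftMul_tmul, lmulSnd_tmul, braidVT_mul]
      generalize c.braidVT (v ⊗ₜ x) = t
      induction t with
      | zero => simp
      | add a b ha hb => simp only [add_tmul, map_add, ha, hb]
      | tmul a b =>
        rw [mulBraid_tmul, braidVT_ι]
        simp only [LinearMap.lTensor_tmul, LinearMap.comp_apply, LinearMap.flip_apply, mk_apply,
          head_tmul]
        generalize c.c (b ⊗ₜ p) = r
        induction r with
        | zero => simp
        | add a b ha hb => simp only [add_tmul, tmul_add, map_add, ha, hb]
        | tmul m n => simp [shiftMul_tmul]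

theorem lTensor_mulRight_lmulSnd (y : TensorAlgebra K V) (v : V)
    (z : TensorAlgebra K V ⊗[K] TensorAlgebra K V) :
    (LinearMap.mulRight K y).lTensor _ (c.lmulSnd (v ⊗ₜ z)) =
      c.lmulSnd (v ⊗ₜ (LinearMap.mulRight K y).lTensor _ z) := by
  induction z with
  | zero => simp
  | add a b ha hb => simp only [tmul_add, map_add, ha, hb]
  | tmul x y =>
    rw [LinearMap.lTensor_tmul, lmulSnd_tmul, lmulSnd_tmul]
    generalize c.braidVT (v ⊗ₜ x) = t
    induction t with
    | zero => simp
    | add a b ha hb => simp only [add_tmul, map_add, ha, hb]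
    | tmul a b => simp [mul_assoc]

/-- `Δ (x * w) = Δ x (w ⊗ 1 + 1 ⊗ w)`. -/
theorem comul_mul_ι (x : TensorAlgebra K V) (w : V) :
    c.comul (x * ι K w) =
      c.rmulFst w (c.comul x) + (LinearMap.mulRight K (ι K w)).lTensor _ (c.comul x) := by
  induction x using left_induction with
  | one =>
    rw [one_mul, comul_ι, comul_one, rmulFst_tmul, braidWith_one, shiftMul_tmul]
    simp
  | add x y hx hy => simp only [add_mul, map_add, hx, hy]; abel
  | smul k x hx => simp only [smul_mul_assoc, map_smul, hx, smul_add]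
  | ι_mul v x ih =>
    rw [mul_assoc, comul_ι_mul, ih, comul_ι_mul, tmul_add, map_add, map_add, map_add, map_add,
      rmulFst_lmulTensor, rmulFst_lmulSnd, lTensor_mulRight_lmulSnd, lTensor_comp_lmulTensor,
      LinearMap.lTensor_tmul, LinearMap.lTensor_tmul]
    abel

/-! ### The enveloping ideal is a braided coideal -/

variable {c} {b : c.E →ₗ[K] V}

theorem projU_surjective : Function.Surjective (c.projU b) :=
  (c.envelopingIdeal b).ringCon.mkₐ_surjective

theorem projU_eq_zero_iff {x : TensorAlgebra K V} :
    c.projU b x = 0 ↔ x ∈ c.envelopingIdeal b := by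
  rw [TwoSidedIdeal.mem_iff]
  exact Quotient.eq''

theorem projU_coe_E (z : c.E) : c.projU b z = c.projU b (ι K (b z)) := by
  rw [← sub_eq_zero, ← map_sub, projU_eq_zero_iff]
  exact TwoSidedIdeal.subset_span ⟨z, rfl⟩

theorem projU_comp_subtype :
    (c.projU b).toLinearMap ∘ₗ c.E.subtype = (c.projU b).toLinearMap ∘ₗ ι K ∘ₗ b :=
  LinearMap.ext projU_coe_E

/-- Stability of the enveloping ideal under braiding with a letter from the left. On a generator z -
b(z) this is the bracket identity c (V ⊗ b) = (b ⊗ V) c_{V,E}, because the projection to U does not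
distinguish E from its image under b. The hexagon axiom propagates it to the ideal. -/
theorem rTensor_projU_braidVT (hb : c.IsBracket b) {x : TensorAlgebra K V}
    (hx : x ∈ c.envelopingIdeal b) (v : V) :
    (c.projU b).toLinearMap.rTensor V (c.braidVT (v ⊗ₜ x)) = 0 := by
  -- All v are taken at once because crossing a letter u replaces v by other vectors.
  let S : Submodule K (TensorAlgebra K V) :=
    { carrier := {x | ∀ v, (c.projU b).toLinearMap.rTensor V (c.braidVT (v ⊗ₜ x)) = 0}
      zero_mem' := by simp
      add_mem' := fun hx hy v => by rw [tmul_add, map_add, map_add, hx, hy, add_zero]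
      smul_mem' := fun k x hx v => by rw [tmul_smul, map_smul, map_smul, hx, smul_zero] }
  refine mem_of_mem_span S ?_ ?_ ?_ hx v
  · rintro _ ⟨z, rfl⟩ v
    have h := LinearMap.congr_fun hb.right (v ⊗ₜ z)
    have h' := rTensor_subtype_restrictLeft c.E c.braidVT
      (fun _ hx v => c.braidVT_mem hx v) (v ⊗ₜ z)
    rw [LinearMap.lTensor_tmul, Submodule.subtype_apply] at h'
    rw [LinearMap.comp_apply, LinearMap.comp_apply, LinearMap.lTensor_tmul] at h
    rw [tmul_sub, map_sub, map_sub, braidVT_ι, h, ← h', ← LinearMap.comp_apply,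
      ← LinearMap.rTensor_comp, projU_comp_subtype, LinearMap.rTensor_comp, LinearMap.rTensor_comp]
    exact sub_self _
  · intro u x hx v
    have e : ∀ z, (c.projU b).toLinearMap.rTensor V (lmulTensor K V V z) =
        extendBy (TensorProduct.lift (LinearMap.mul K (c.U b) ∘ₗ c.inclU b)) V
          (((c.projU b).toLinearMap.rTensor V).lTensor V z) := by
      intro z
      rw [← LinearMap.comp_apply, ← LinearMap.comp_apply (extendBy _ V)]
      congr 1
      ext u x v
      simp [extendBy_tmul, inclU]
    rw [braidVT_ι_mul, e, lTensor_comp_apply, head_tmul,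
      lTensor_assoc_congr (g := 0) (fun v => hx v)]
    simp
  · intro u x hx v
    -- Crossing the last letter u depends on the earlier crossing only through its image in U ⊗ V,
    -- which is zero for x in S.
    have e : ∀ z, (c.projU b).toLinearMap.rTensor V (c.mulBraid (ι K u) z) =
        (TensorProduct.lift ((LinearMap.mul K (c.U b)).compl₂ (c.inclU b))).rTensor V
          ((TensorProduct.assoc K _ V V).symm ((c.c ∘ₗ (TensorProduct.mk K V V).flip u).lTensor _
            ((c.projU b).toLinearMap.rTensor V z))) := by
      intro z
      induction z with
      | zero => simp
      | add a b ha hb => simp only [map_add, ha, hb]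
      | tmul x v =>
        rw [mulBraid_tmul, braidVT_ι, LinearMap.rTensor_tmul, LinearMap.lTensor_tmul,
          LinearMap.comp_apply, LinearMap.flip_apply, mk_apply]
        generalize c.c (v ⊗ₜ u) = r
        induction r with
        | zero => simp
        | add a b ha hb => simp only [tmul_add, map_add, ha, hb]
        | tmul m n => simp [inclU]
    rw [braidVT_mul, e, hx v]
    simp

/-- The mirror statement, from the bracket identity c (b ⊗ V) = (V ⊗ b) c_{E,V}. -/
theorem lTensor_projU_braidWith (hb : c.IsBracket b) {x : TensorAlgebra K V}
    (hx : x ∈ c.envelopingIdeal b) (w : V) :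
    (c.projU b).toLinearMap.lTensor V (c.braidWith w x) = 0 := by
  let S : Submodule K (TensorAlgebra K V) :=
    { carrier := {x | ∀ w, (c.projU b).toLinearMap.lTensor V (c.braidWith w x) = 0}
      zero_mem' := by simp
      add_mem' := fun hx hy v => by rw [map_add, map_add, hx, hy, add_zero]
      smul_mem' := fun k x hx v => by rw [map_smul, map_smul, hx, smul_zero] }
  refine mem_of_mem_span S ?_ ?_ ?_ hx w
  · rintro _ ⟨z, rfl⟩ w
    have h := LinearMap.congr_fun hb.left (z ⊗ₜ w)
    have h' := lTensor_subtype_restrictRight c.E c.braidTV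
      (fun _ hx v => c.braidTV_mem hx v) (z ⊗ₜ w)
    rw [LinearMap.rTensor_tmul, Submodule.subtype_apply] at h'
    rw [LinearMap.comp_apply, LinearMap.comp_apply, LinearMap.rTensor_tmul] at h
    rw [map_sub, map_sub, braidWith_ι, h, braidWith_apply, ← h', ← LinearMap.comp_apply,
      ← LinearMap.lTensor_comp, projU_comp_subtype, LinearMap.lTensor_comp, LinearMap.lTensor_comp]
    exact sub_self _
  · intro u x hx w
    have e : (c.projU b).toLinearMap ∘ₗ lmul K V =
        TensorProduct.lift (LinearMap.mul K (c.U b) ∘ₗ c.inclU b) ∘ₗ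
          (c.projU b).toLinearMap.lTensor V := by
      ext u x
      simp [inclU]
    rw [braidWith_ι_mul, lTensor_comp_apply, e, LinearMap.lTensor_comp, LinearMap.comp_apply,
      head_naturality, LinearMap.lTensor_tmul, hx w]
    simp
  · intro u x hx w
    rw [braidWith_mul, braidWith_ι]
    generalize c.c (u ⊗ₜ w) = t
    induction t with
    | zero => simp
    | add a b ha hb => simp only [tmul_add, map_add, ha, hb, add_zero]
    | tmul p q =>
      have e : (c.projU b).toLinearMap ∘ₗ LinearMap.mulRight K (ι K q) =
          LinearMap.mulRight K (c.projU b (ι K q)) ∘ₗ (c.projU b).toLinearMap := by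
        ext x
        simp
      rw [LinearMap.lTensor_tmul, braidMul_tmul, lTensor_comp_apply, e, LinearMap.lTensor_comp,
        LinearMap.comp_apply, hx p, map_zero]

/-- The kernel of `T(V) ⊗ T(V) → U ⊗ U` is spanned by `I ⊗ T(V)` and `T(V) ⊗ I`, where `I` is
the enveloping ideal. -/
theorem eq_zero_of_map_projU_eq_zero (g : TensorAlgebra K V ⊗[K] TensorAlgebra K V →ₗ[K] X)
    (left : ∀ x y, x ∈ c.envelopingIdeal b → g (x ⊗ₜ y) = 0)
    (right : ∀ x y, y ∈ c.envelopingIdeal b → g (x ⊗ₜ y) = 0)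
    {t : TensorAlgebra K V ⊗[K] TensorAlgebra K V}
    (ht : TensorProduct.map (c.projU b).toLinearMap (c.projU b).toLinearMap t = 0) : g t = 0 := by
  have hex := LinearMap.exact_subtype_ker_map (c.projU b).toLinearMap
  have ht' := LinearMap.mem_ker.mpr ht
  rw [TensorProduct.map_ker hex projU_surjective hex projU_surjective] at ht'
  obtain ⟨_, ⟨r, rfl⟩, _, ⟨s, rfl⟩, rfl⟩ := Submodule.mem_sup.mp ht'
  have h₁ : g ∘ₗ (LinearMap.ker (c.projU b).toLinearMap).subtype.lTensor _ = 0 :=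
    TensorProduct.ext' fun x y => right _ _ (projU_eq_zero_iff.mp y.2)
  have h₂ : g ∘ₗ (LinearMap.ker (c.projU b).toLinearMap).subtype.rTensor _ = 0 :=
    TensorProduct.ext' fun x y => left _ _ (projU_eq_zero_iff.mp x.2)
  rw [map_add, ← LinearMap.comp_apply, ← LinearMap.comp_apply, h₁, h₂]
  simp

/-- The enveloping ideal is a coideal. -/
theorem map_projU_comul (hb : c.IsBracket b) {x : TensorAlgebra K V}
    (hx : x ∈ c.envelopingIdeal b) :
    TensorProduct.map (c.projU b).toLinearMap (c.projU b).toLinearMap (c.comul x) = 0 := by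
  let π₂ := TensorProduct.map (c.projU b).toLinearMap (c.projU b).toLinearMap
  have hI : ∀ {y}, y ∈ c.envelopingIdeal b → c.projU b y = 0 := projU_eq_zero_iff.mpr
  have h0 : ∀ {z}, (c.projU b).toLinearMap.rTensor V z = 0 → ∀ y, π₂ ((lmul K V).lTensor _
      (TensorProduct.assoc K _ V _ (z ⊗ₜ y))) = 0 := by
    intro z hz y
    have e : π₂ ((lmul K V).lTensor _ (TensorProduct.assoc K _ V _ (z ⊗ₜ y))) =
        ((c.projU b).toLinearMap ∘ₗ lmul K V ∘ₗ (TensorProduct.mk K V _).flip y).lTensor _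
          ((c.projU b).toLinearMap.rTensor V z) := by
      clear hz
      induction z with
      | zero => simp
      | add a b ha hb => simp only [add_tmul, map_add, ha, hb]
      | tmul a b => simp [π₂]
    rw [e, hz, map_zero]
  have h1 : ∀ {z}, (c.projU b).toLinearMap.lTensor V z = 0 → ∀ x, π₂ (shiftMul (x ⊗ₜ z)) = 0 := by
    intro z hz x
    have e : π₂ (shiftMul (x ⊗ₜ z)) =
        ((c.projU b).toLinearMap ∘ₗ LinearMap.mulLeft K x ∘ₗ ι K).rTensor _
          ((c.projU b).toLinearMap.lTensor V z) := by
      clear hz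
      induction z with
      | zero => simp
      | add a b ha hb => simp only [tmul_add, map_add, ha, hb]
      | tmul a b => simp [π₂, shiftMul_tmul]
    rw [e, hz, map_zero]
  refine mem_of_mem_span (LinearMap.ker (π₂ ∘ₗ c.comul)) ?_ ?_ ?_ hx
  -- Both z and b(z) are primitive, so Δ(z - b(z)) is (z - b(z)) ⊗ 1 + 1 ⊗ (z - b(z)).
  · rintro _ ⟨z, rfl⟩
    rw [LinearMap.mem_ker, LinearMap.comp_apply, map_sub, comul_ι, c.comul_of_mem_E z.2]
    simp [π₂, projU_coe_E]
  · intro v x hx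
    rw [LinearMap.mem_ker, LinearMap.comp_apply, comul_ι_mul, map_add]
    -- Since Δx lies in I ⊗ T + T ⊗ I, multiplication by v ⊗ 1 and by 1 ⊗ v need only be tested on
    -- these two pieces. The one delicate case is (1 ⊗ v)(I ⊗ T), where v has to cross I; braiding
    -- stability settles it.
    have e₁ := eq_zero_of_map_projU_eq_zero
      (π₂ ∘ₗ lmulTensor K V _ ∘ₗ TensorProduct.mk K V _ v)
      (fun x y hx => by simp [π₂, hI hx]) (fun x y hy => by simp [π₂, hI hy]) hx
    have e₂ := eq_zero_of_map_projU_eq_zero (π₂ ∘ₗ c.lmulSnd ∘ₗ TensorProduct.mk K V _ v)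
      (fun x y hx => by
        simpa [lmulSnd_tmul] using h0 (rTensor_projU_braidVT hb hx v) y)
      (fun x y hy => by
        simp only [LinearMap.comp_apply, mk_apply, lmulSnd_tmul]
        generalize c.braidVT (v ⊗ₜ x) = t
        induction t with
        | zero => simp
        | add a b ha hb => simp only [add_tmul, map_add, ha, hb, add_zero]
        | tmul a b => simp [π₂, hI hy]) hx
    simp only [LinearMap.comp_apply, mk_apply] at e₁ e₂
    rw [e₁, e₂, add_zero]
  · intro w x hx
    rw [LinearMap.mem_ker, LinearMap.comp_apply, comul_mul_ι, map_add]
    have e₁ := eq_zero_of_map_projU_eq_zero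
      (π₂ ∘ₗ (LinearMap.mulRight K (ι K w)).lTensor _)
      (fun x y hx => by simp [π₂, hI hx]) (fun x y hy => by simp [π₂, hI hy]) hx
    -- On the right the delicate case is (T ⊗ I)(w ⊗ 1), where w has to cross I.
    have e₂ := eq_zero_of_map_projU_eq_zero (π₂ ∘ₗ c.rmulFst w)
      (fun x y hx => by
        simp only [LinearMap.comp_apply, rmulFst_tmul]
        generalize c.braidWith w y = t
        induction t with
        | zero => simp
        | add a b ha hb => simp only [tmul_add, map_add, ha, hb, add_zero]
        | tmul a b => simp [π₂, shiftMul_tmul, hI hx])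
      (fun x y hy => by
        simpa [rmulFst_tmul] using h1 (lTensor_projU_braidWith hb hy w) x) hx
    simp only [LinearMap.comp_apply] at e₁ e₂
    rw [e₁, e₂, add_zero]

end Braiding

namespace Braiding

variable (c : Braiding K V)

/-! ### The left skew derivation -/

/-- One step of the recursion for `deriv`. -/
noncomputable def derivStep : V →ₗ[K]
    Module.End K (TensorAlgebra K V × (V ⊗[K] TensorAlgebra K V)) :=
  LinearMap.mk₂ K (fun u p => (ι K u * p.1,
      u ⊗ₜ p.1 + (lmul K V).lTensor V (c.head _ (u ⊗ₜ p.2))))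
    (fun _ _ _ => by ext <;> simp [add_mul, add_tmul, add_add_add_comm])
    (fun _ _ _ => by ext <;> simp [← smul_tmul'])
    (fun _ _ _ => by ext <;> simp [mul_add, tmul_add, add_add_add_comm])
    (fun _ _ _ => by ext <;> simp)

theorem derivStep_apply (u : V) (p : TensorAlgebra K V × (V ⊗[K] TensorAlgebra K V)) :
    c.derivStep u p = (ι K u * p.1,
      u ⊗ₜ p.1 + (lmul K V).lTensor V (c.head _ (u ⊗ₜ p.2))) := rfl

/-- The map `T(V) → V ⊗ T(V)` whose component on `V^{⊗ n}` is `Δ^{1, n-1}`. -/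
noncomputable def deriv : TensorAlgebra K V →ₗ[K] V ⊗[K] TensorAlgebra K V :=
  LinearMap.snd K _ _ ∘ₗ leftRec c.derivStep (1, 0)

@[simp]
theorem deriv_one : c.deriv 1 = 0 := by simp [deriv]

/-- A skew Leibniz rule: the letter split off is u itself, or it is split off from x and then
brought to the front past u by c. -/
theorem deriv_ι_mul (u : V) (x : TensorAlgebra K V) :
    c.deriv (ι K u * x) = u ⊗ₜ x + (lmul K V).lTensor V (c.head _ (u ⊗ₜ c.deriv x)) := by
  -- The first component of the recursion only carries x along, for use in the summand u ⊗ x.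
  have h : ∀ x, (leftRec c.derivStep (1, 0) x).1 = x := by
    intro x
    induction x using left_induction with
    | one => simp
    | add x y hx hy => simp [hx, hy]
    | smul k x hx => simp [hx]
    | ι_mul v x hx => simp [derivStep_apply, hx]
  simp [deriv, derivStep_apply, h]

theorem gamma_comp_lmul : c.gamma ∘ₗ lmul K V = c.shuffle ∘ₗ c.gamma.lTensor V :=
  TensorProduct.ext' fun v x => by simp [gamma_ι_mul]

/-- The factorization of the quantum symmetrizer through `Δ^{1, n-1}`. -/
theorem gamma_eq_lmul_deriv (x : TensorAlgebra K V) :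
    c.gamma x = degProj K V 0 x + lmul K V (c.gamma.lTensor V (c.deriv x)) := by
  induction x using left_induction with
  | one => simp
  | add x y hx hy => rw [map_add, hx, hy]; simp only [map_add]; abel
  | smul k x hx => rw [map_smul, hx]; simp only [map_smul, smul_add]
  | ι_mul v x ih =>
    have e : ∀ z, c.shuffle (v ⊗ₜ lmul K V z) = ι K v * lmul K V z +
        lmul K V (c.shuffle.lTensor V (c.head _ (v ⊗ₜ z))) := by
      intro z
      simpa using LinearMap.congr_fun c.shuffle_comp_lmul (v ⊗ₜ z)
    -- Degree zero is separate: a scalar has no letter for v to cross, so the shuffle has no braided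
    -- term.
    have e₀ : c.shuffle (v ⊗ₜ degProj K V 0 x) = ι K v * degProj K V 0 x := by
      rw [degProj_zero_eq, Algebra.algebraMap_eq_smul_one, tmul_smul, map_smul, shuffle_one]
      simp
    -- The terms with v in front recombine to v Γ(x), which matches the summand v ⊗ x of the Leibniz
    -- rule; the remaining ones match its braided summand.
    rw [gamma_ι_mul, deriv_ι_mul, degProj_zero_ι_mul, zero_add, map_add, map_add,
      LinearMap.lTensor_tmul, lmul_tmul, lTensor_comp_apply, gamma_comp_lmul,
      LinearMap.lTensor_comp, LinearMap.comp_apply, head_naturality, LinearMap.lTensor_tmul, ih,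
      tmul_add, map_add, e, e₀, mul_add, add_assoc]

/-- On V ⊗ T(V), left multiplication by 1 ⊗ v is the braided summand in the recursion of `deriv`.
This is what ties `deriv` to Δ. -/
theorem lmulSnd_rTensor_ι (v : V) (z : V ⊗[K] TensorAlgebra K V) :
    c.lmulSnd (v ⊗ₜ (ι K).rTensor _ z) =
      (ι K).rTensor _ ((lmul K V).lTensor V (c.head _ (v ⊗ₜ z))) := by
  induction z with
  | zero => simp
  | add a b ha hb => simp only [tmul_add, map_add, ha, hb]
  | tmul u x =>
    rw [LinearMap.rTensor_tmul, lmulSnd_tmul, braidVT_ι, head_tmul]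
    generalize c.c (v ⊗ₜ u) = t
    induction t with
    | zero => simp
    | add a b ha hb => simp only [add_tmul, map_add, ha, hb]
    | tmul a b => simp

theorem lTensor_degProj_comul_of_lt {n m : ℕ} (h : n < m) (x : TensorAlgebra K V) :
    (degProj K V m).lTensor _ (c.comul (degProj K V n x)) = 0 := by
  apply eq_zero_of_map_degProj
  intro p q
  rw [← LinearMap.comp_apply, LinearMap.map_comp_lTensor]
  by_cases hq : m = q
  · subst hq
    have e : degProj K V m ∘ₗ degProj K V m = degProj K V m :=
      LinearMap.ext (degProj_degProj m)
    rw [e]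
    exact c.comulPart_degProj_of_ne (by omega) x
  · have e : degProj K V q ∘ₗ degProj K V m = 0 :=
      LinearMap.ext (degProj_degProj_of_ne hq)
    simp [e]

theorem lTensor_degProj_comul_self (n : ℕ) (x : TensorAlgebra K V) :
    (degProj K V n).lTensor _ (c.comul (degProj K V n x)) = 1 ⊗ₜ degProj K V n x := by
  induction x using left_induction generalizing n with
  | one => cases n <;> simp
  | add x y hx hy => simp only [map_add, tmul_add, hx, hy]
  | smul k x hx => simp only [map_smul, tmul_smul, hx]
  | ι_mul v x ih =>
    cases n with
    | zero => simp
    | succ n =>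
      rw [degProj_succ_ι_mul, comul_ι_mul, map_add, lTensor_comp_lmulTensor,
        lTensor_degProj_succ_lmulSnd, LinearMap.lTensor_tmul,
        lTensor_degProj_comul_of_lt _ (Nat.lt_succ_self n), ih, lmulSnd_one_tmul, tmul_zero,
        map_zero, zero_add]

/-- In total degree n+1, second degree n forces first degree one, so this identifies Δ^{1,n} with
`deriv`. In the recursion v ⊗ 1 meets the component 1 ⊗ x of Δx, and 1 ⊗ v gives the braided
summand. -/
theorem lTensor_degProj_comul_succ (n : ℕ) (x : TensorAlgebra K V) :
    (degProj K V n).lTensor _ (c.comul (degProj K V (n + 1) x)) =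
      (ι K).rTensor _ (c.deriv (degProj K V (n + 1) x)) := by
  induction x using left_induction generalizing n with
  | one => simp
  | add x y hx hy => simp only [map_add, hx, hy]
  | smul k x hx => simp only [map_smul, hx]
  | ι_mul v x ih =>
    rw [degProj_succ_ι_mul, comul_ι_mul, map_add, lTensor_comp_lmulTensor,
      LinearMap.lTensor_tmul, lTensor_degProj_comul_self, lmulTensor_tmul, mul_one, deriv_ι_mul,
      map_add, LinearMap.rTensor_tmul, ← lmulSnd_rTensor_ι]
    congr 1
    cases n with
    | zero =>
      rw [lTensor_degProj_zero_lmulSnd, degProj_zero_eq, Algebra.algebraMap_eq_smul_one]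
      simp
    | succ n => rw [lTensor_degProj_succ_lmulSnd, ih]

/-- `x ↦ (f ⊗ T(V)) (Δ x)`, for a linear form `f` on `T(V)`. -/
noncomputable def skewDeriv (f : TensorAlgebra K V →ₗ[K] K) :
    TensorAlgebra K V →ₗ[K] TensorAlgebra K V :=
  (TensorProduct.lid K _).toLinearMap ∘ₗ f.rTensor _ ∘ₗ c.comul

theorem degProj_skewDeriv (f : TensorAlgebra K V →ₗ[K] K) (n : ℕ) (x : TensorAlgebra K V) :
    degProj K V n (c.skewDeriv f x) =
      TensorProduct.lid K _ (f.rTensor _ ((degProj K V n).lTensor _ (c.comul x))) := by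
  simp only [skewDeriv, LinearMap.comp_apply, LinearEquiv.coe_coe]
  generalize c.comul x = t
  induction t with
  | zero => simp
  | add a b ha hb => simp only [map_add, ha, hb]
  | tmul a b => simp

/-! ### Leading terms of elements of the enveloping ideal -/

variable {c} {b : c.E →ₗ[K] V}

theorem algebraMapInv_of_mem_E {z : TensorAlgebra K V} (hz : z ∈ c.E) : algebraMapInv z = 0 := by
  induction hz using Submodule.iSup_induction' with
  | zero => simp
  | add x y _ _ hx hy => rw [map_add, hx, hy, add_zero]
  | mem n x hx =>
    by_cases hn : n ≤ 1
    · rw [En, if_pos hn] at hx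
      simp [(Submodule.mem_bot K).mp hx]
    · rw [mem_En_iff _ (by omega)] at hx
      have h := degProj_zero_eq x
      rw [← hx.1, degProj_degProj_of_ne (by omega), hx.1] at h
      simpa using congrArg algebraMapInv h.symm

/-- The augmentation kills E and V, hence the generators. It can therefore be used to change the
value of a form at 1 without disturbing its values on the ideal. -/
theorem algebraMapInv_of_mem_envelopingIdeal {x : TensorAlgebra K V}
    (hx : x ∈ c.envelopingIdeal b) : algebraMapInv x = 0 := by
  refine mem_of_mem_span (LinearMap.ker (algebraMapInv (R := K) (M := V)).toLinearMap) ?_ ?_ ?_ hx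
  · rintro _ ⟨z, rfl⟩
    have h : algebraMapInv (ι K (b z)) = 0 := by simp [algebraMapInv]
    simp [algebraMapInv_of_mem_E z.2, h]
  · intro v x hx
    simp_all
  · intro v x hx
    simp_all

/-- A linear form on `V` extends to a linear form on `T(V)` which vanishes on the enveloping
ideal and at `1`. -/
theorem IsBraidedLieAlgebra.exists_extend (hb : c.IsBraidedLieAlgebra b) (φ : V →ₗ[K] K) :
    ∃ f : TensorAlgebra K V →ₗ[K] K, f ∘ₗ ι K = φ ∧ f 1 = 0 ∧
      ∀ x ∈ c.envelopingIdeal b, f x = 0 := by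
  obtain ⟨L, hL⟩ := LinearMap.exists_leftInverse_of_injective (c.inclU b)
    (LinearMap.ker_eq_bot.mpr hb.inclU_injective)
  let g : TensorAlgebra K V →ₗ[K] K := φ ∘ₗ L ∘ₗ (c.projU b).toLinearMap
  -- A left inverse of V → U makes g an extension of φ that vanishes on the ideal. Subtracting g(1)
  -- times the augmentation kills the value at 1 and changes nothing on V or on the ideal.
  refine ⟨g - (algebraMapInv (R := K) (M := V)).toLinearMap.smulRight (g 1), ?_, ?_, ?_⟩
  · ext v
    have := LinearMap.congr_fun hL v
    simpa [g, inclU, algebraMapInv] using congrArg φ this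
  · simp
  · intro x hx
    simp [g, projU_eq_zero_iff.mpr hx, algebraMapInv_of_mem_envelopingIdeal hx]

/-- With I the ideal, Δ(I) lies in I ⊗ T + T ⊗ I; the form f kills the first piece and sends the
second into I. -/
theorem skewDeriv_mem_envelopingIdeal (hb : c.IsBracket b) {f : TensorAlgebra K V →ₗ[K] K}
    (hf : ∀ x ∈ c.envelopingIdeal b, f x = 0) {x : TensorAlgebra K V}
    (hx : x ∈ c.envelopingIdeal b) : c.skewDeriv f x ∈ c.envelopingIdeal b := by
  rw [← projU_eq_zero_iff]
  exact eq_zero_of_map_projU_eq_zero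
    ((c.projU b).toLinearMap ∘ₗ (TensorProduct.lid K _).toLinearMap ∘ₗ f.rTensor _)
    (fun x y hx => by simp [hf x hx]) (fun x y hy => by simp [projU_eq_zero_iff.mpr hy])
    (map_projU_comul hb hx)

/-- The leading term of an element of the enveloping ideal vanishes in the Nichols algebra. -/
theorem IsBraidedLieAlgebra.gamma_degProj_eq_zero (hb : c.IsBraidedLieAlgebra b) {n : ℕ}
    {x : TensorAlgebra K V} (hx : x ∈ c.envelopingIdeal b)
    (hn : ∀ k > n, degProj K V k x = 0) : c.gamma (degProj K V n x) = 0 := by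
  induction n generalizing x with
  -- The constant term is given by the augmentation, which vanishes on the ideal.
  | zero => simp [degProj_zero_eq, algebraMapInv_of_mem_envelopingIdeal hx]
  | succ n ih =>
    rw [gamma_eq_lmul_deriv, degProj_degProj_of_ne (Nat.succ_ne_zero n), zero_add]
    -- Vanishing is phrased as membership in V ⊗ 0, so that it can be tested by all linear forms φ
    -- on V.
    suffices h : c.gamma.lTensor V (c.deriv (degProj K V (n + 1) x)) ∈
        LinearMap.range ((⊥ : Submodule K (TensorAlgebra K V)).subtype.lTensor V) by
      obtain ⟨y, hy⟩ := h
      have : (⊥ : Submodule K (TensorAlgebra K V)).subtype = 0 := by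
        ext z; exact (Submodule.mem_bot K).mp z.2
      rw [← hy, this]
      simp
    apply mem_range_lTensor
    intro φ
    rw [Submodule.mem_bot, ← lid_rTensor_lTensor]
    obtain ⟨f, hfι, hf1, hf⟩ := hb.exists_extend φ
    have hsum : ∀ m, degProj K V m (c.skewDeriv f x) = ∑ k ∈ Finset.range (n + 2),
        TensorProduct.lid K _ (f.rTensor _
          ((degProj K V m).lTensor _ (c.comul (degProj K V k x)))) := by
      intro m
      rw [degProj_skewDeriv]
      conv_lhs => rw [← sum_degProj hn]
      simp only [map_sum]
    -- The summand 1 ⊗ x of Δx is lost because f(1) = 0; this is why the skew derivation strictly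
    -- lowers the degree.
    have hself : ∀ k, TensorProduct.lid K _ (f.rTensor _
        ((degProj K V k).lTensor _ (c.comul (degProj K V k x)))) = 0 := by
      intro k
      rw [lTensor_degProj_comul_self]
      simp [hf1]
    have hlt : ∀ k m, k < m → TensorProduct.lid K _ (f.rTensor _
        ((degProj K V m).lTensor _ (c.comul (degProj K V k x)))) = 0 := by
      intro k m h
      rw [lTensor_degProj_comul_of_lt _ h]
      simp
    -- In degree n only the components of x of degrees n and n+1 could contribute. The former gives
    -- f(1) = 0, the latter Δ^{1,n}, where f acts as φ.
    have htop : degProj K V n (c.skewDeriv f x) =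
        TensorProduct.lid K _ (φ.rTensor _ (c.deriv (degProj K V (n + 1) x))) := by
      rw [hsum, Finset.sum_range_succ, Finset.sum_range_succ, Finset.sum_eq_zero fun k hk =>
        hlt k n (Finset.mem_range.mp hk), hself, lTensor_degProj_comul_succ, ← LinearMap.comp_apply
        (f.rTensor _), ← LinearMap.rTensor_comp, hfι, zero_add, zero_add]
    rw [← htop]
    -- The skew derivative of x is again in the ideal, now of degree at most n, and its degree n
    -- component is the element to be killed by Γ.
    refine ih (skewDeriv_mem_envelopingIdeal hb.isBracket hf hx) fun m hm => ?_
    rw [hsum]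
    refine Finset.sum_eq_zero fun k hk => ?_
    rw [Finset.mem_range] at hk
    rcases (by omega : k < m ∨ k = m) with h | rfl
    · exact hlt k m h
    · exact hself k

end Braiding

namespace TensorAlgebra

theorem degPart_two : degPart K V 2 = LinearMap.range (ι₂ K V) := by
  apply le_antisymm
  · rw [degPart, pow_two, Submodule.mul_le]
    rintro _ ⟨v, rfl⟩ _ ⟨w, rfl⟩
    exact ⟨v ⊗ₜ w, ι₂_tmul v w⟩
  · rintro _ ⟨z, rfl⟩
    exact Braiding.ι₂_mem_degPart z

end TensorAlgebra

namespace Braiding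

variable {c : Braiding K V}

/-! ### Quadratic Nichols algebras -/

theorem gamma_ι (v : V) : c.gamma (ι K v) = ι K v := by
  rw [← mul_one (ι K v), gamma_ι_mul]; simp

theorem gamma_ι₂ (z : V ⊗[K] V) : c.gamma (ι₂ K V z) = ι₂ K V (z + c.c z) := by
  induction z with
  | zero => simp
  | add x y hx hy => simp only [map_add, hx, hy]; abel
  | tmul v w =>
    rw [ι₂_tmul, gamma_ι_mul, gamma_ι, ← mul_one (ι K w), shuffle_ι_mul, mul_one, map_add, ι₂_tmul,
      head_tmul]
    congr 1
    generalize c.c (v ⊗ₜ w) = t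
    induction t with
    | zero => simp
    | add a b ha hb => simp only [map_add, add_tmul, ha, hb]
    | tmul a b => simp

/-- Γ is id + c in degree two, so the quadratic relations of the Nichols algebra are exactly E₂. -/
theorem gamma_ι₂_eq_zero_iff {z : V ⊗[K] V} : c.gamma (ι₂ K V z) = 0 ↔ z ∈ c.E₂ := by
  rw [gamma_ι₂, map_eq_zero_iff _ ι₂_injective, mem_E₂, add_comm, add_eq_zero_iff_eq_neg]

/-- Γ is the identity on V, so there are no relations in degree one. This allows T(V) to be
identified with the tensor algebra on the degree one part of the Nichols algebra. -/
theorem nicholsι_bijective : Function.Bijective c.nicholsι := by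
  constructor
  · rw [injective_iff_map_eq_zero]
    intro v hv
    have h := congrArg Subtype.val hv
    rw [coe_nicholsι, ZeroMemClass.coe_zero, nicholsProj_eq_zero_iff, gamma_ι] at h
    simpa using h
  · rintro ⟨_, x, hx, rfl⟩
    rw [SetLike.mem_coe, degPart, pow_one] at hx
    obtain ⟨v, rfl⟩ := hx
    exact ⟨v, rfl⟩

/-- If the Nichols algebra is quadratic, then the kernel of `Γ` is generated by `E₂`. -/
theorem mem_span_of_gamma_eq_zero (hB : IsQuadraticAlgebra K c.nicholsGrading)
    {x : TensorAlgebra K V} (hx : c.gamma x = 0) :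
    x ∈ TwoSidedIdeal.span {t | ∃ z ∈ c.E₂, t = ι₂ K V z} := by
  let e : V ≃ₗ[K] c.nicholsGrading 1 := LinearEquiv.ofBijective c.nicholsι nicholsι_bijective
  -- Quadraticity is a statement about the tensor algebra on the degree one component, so x is
  -- carried there by θ and the outcome is brought back by θ'.
  let θ : TensorAlgebra K V →ₐ[K] TensorAlgebra K (c.nicholsGrading 1) :=
    TensorAlgebra.lift K (ι K ∘ₗ e.toLinearMap)
  let θ' : TensorAlgebra K (c.nicholsGrading 1) →ₐ[K] TensorAlgebra K V :=
    TensorAlgebra.lift K (ι K ∘ₗ e.symm.toLinearMap)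
  let L := TensorAlgebra.lift K (c.nicholsGrading 1).subtype
  have hθ : ∀ x, θ' (θ x) = x := by
    intro x
    have : θ'.comp θ = AlgHom.id K _ := by ext v; simp [θ, θ']
    exact DFunLike.congr_fun this x
  have hL : ∀ y, c.nicholsProj (θ' y) = L y := by
    intro y
    have : c.nicholsProj.comp θ' = L := by
      ext v
      obtain ⟨v, rfl⟩ := e.surjective v
      simp [θ', L]
      rfl
    exact DFunLike.congr_fun this y
  have hmem : θ x ∈ TwoSidedIdeal.ker L := by
    rw [TwoSidedIdeal.mem_ker, ← hL, hθ, nicholsProj_eq_zero_iff, hx]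
  rw [hB.ker_eq, TwoSidedIdeal.mem_span_iff] at hmem
  -- It is enough that the pullback along θ' of the ideal generated by E₂ contains every degree two
  -- relation. Such a relation maps to a degree two element killed by Γ, that is, into E₂.
  have h := hmem (TwoSidedIdeal.comap θ' (TwoSidedIdeal.span {t | ∃ z ∈ c.E₂, t = ι₂ K V z})) ?_
  · rw [TwoSidedIdeal.mem_comap, hθ] at h
    exact h
  · rintro y ⟨hy, hLy⟩
    rw [SetLike.mem_coe, TwoSidedIdeal.mem_comap]
    apply TwoSidedIdeal.subset_span
    rw [degPart_two] at hy
    obtain ⟨z, rfl⟩ := hy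
    have hz : ι₂ K V (TensorProduct.map e.symm.toLinearMap e.symm.toLinearMap z) =
        θ' (ι₂ K _ z) := by
      clear hLy
      induction z with
      | zero => simp
      | add a b ha hb => simp only [map_add, ha, hb]
      | tmul a b => simp [θ']
    refine ⟨_, ?_, hz.symm⟩
    rw [← gamma_ι₂_eq_zero_iff, hz, ← nicholsProj_eq_zero_iff, hL]
    exact hLy

variable {b : c.E →ₗ[K] V}

/-- Every element of the ideal generated by `E₂` has leading terms coming from the quadratic
enveloping ideal. -/
theorem exists_mem_quadEnvelopingIdeal (β : c.E₂ →ₗ[K] V) {x : TensorAlgebra K V}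
    (hx : x ∈ TwoSidedIdeal.span {t | ∃ z ∈ c.E₂, t = ι₂ K V z}) (n : ℕ) :
    ∃ s ∈ c.quadEnvelopingIdeal β, (∀ k > n, degProj K V k s = 0) ∧
      degProj K V n s = degProj K V n x := by
  -- All degrees n are treated at once because multiplication by a letter shifts n.
  let S : Submodule K (TensorAlgebra K V) :=
    { carrier := {x | ∀ n, ∃ s ∈ c.quadEnvelopingIdeal β, (∀ k > n, degProj K V k s = 0) ∧
        degProj K V n s = degProj K V n x}
      zero_mem' := fun n => ⟨0, zero_mem _, by simp⟩
      add_mem' := fun {x y} hx hy n => by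
        obtain ⟨s, hs, hs', hsx⟩ := hx n
        obtain ⟨t, ht, ht', hty⟩ := hy n
        exact ⟨s + t, add_mem hs ht, fun k hk => by simp [hs' k hk, ht' k hk],
          by simp [hsx, hty]⟩
      smul_mem' := fun r x hx n => by
        obtain ⟨s, hs, hs', hsx⟩ := hx n
        refine ⟨r • s, ?_, fun k hk => by simp [hs' k hk], by simp [hsx]⟩
        rw [Algebra.smul_def]
        exact TwoSidedIdeal.mul_mem_left _ _ _ hs }
  refine mem_of_mem_span S ?_ ?_ ?_ hx n
  · rintro _ ⟨z, hz, rfl⟩ n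
    by_cases hn : n = 2
    · subst hn
      -- The element z - β(z) has leading term z, since β(z) has degree one. In degrees other than
      -- two z has no component, and 0 serves.
      refine ⟨_, TwoSidedIdeal.subset_span ⟨⟨z, hz⟩, rfl⟩, fun k hk => ?_, ?_⟩
      · rw [map_sub, degProj_of_mem_ne (by omega) (ι₂_mem_degPart z),
          degProj_of_mem_ne (by omega) (ι_mem_degPart _), sub_zero]
      · rw [map_sub, degProj_of_mem_ne (n := 1) (by omega) (ι_mem_degPart _), sub_zero]
    · exact ⟨0, zero_mem _, by simp,
        by rw [map_zero, degProj_of_mem_ne (Ne.symm hn) (ι₂_mem_degPart z)]⟩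
  · intro v x hx n
    cases n with
    | zero => exact ⟨0, zero_mem _, by simp⟩
    | succ n =>
      obtain ⟨s, hs, hs', hsx⟩ := hx n
      refine ⟨ι K v * s, TwoSidedIdeal.mul_mem_left _ _ _ hs, fun k hk => ?_, ?_⟩
      · obtain ⟨k, rfl⟩ := Nat.exists_eq_succ_of_ne_zero (by omega : k ≠ 0)
        rw [Nat.succ_eq_add_one, degProj_succ_ι_mul, hs' k (by omega), mul_zero]
      · rw [degProj_succ_ι_mul, degProj_succ_ι_mul, hsx]
  · intro v x hx n
    cases n with
    | zero => exact ⟨0, zero_mem _, by simp, by rw [degProj_zero_mul_ι, map_zero]⟩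
    | succ n =>
      obtain ⟨s, hs, hs', hsx⟩ := hx n
      refine ⟨s * ι K v, TwoSidedIdeal.mul_mem_right _ _ _ hs, fun k hk => ?_, ?_⟩
      · obtain ⟨k, rfl⟩ := Nat.exists_eq_succ_of_ne_zero (by omega : k ≠ 0)
        rw [Nat.succ_eq_add_one, degProj_succ_mul_ι, hs' k (by omega), zero_mul]
      · rw [degProj_succ_mul_ι, degProj_succ_mul_ι, hsx]

/-! ### Equality of the two ideals -/

theorem quadEnvelopingIdeal_le : c.quadEnvelopingIdeal (c.restrictE₂ b) ≤ c.envelopingIdeal b := by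
  rw [quadEnvelopingIdeal, TwoSidedIdeal.span_le]
  rintro _ ⟨z, rfl⟩
  exact TwoSidedIdeal.subset_span ⟨⟨ι₂ K V z, c.ι₂_mem_E z.2⟩, rfl⟩

/-- Descending through leading terms: each one is killed by Γ, hence lies in the ideal generated by
E₂, hence is cancelled by an element of the quadratic ideal. -/
theorem IsBraidedLieAlgebra.envelopingIdeal_eq (hb : c.IsBraidedLieAlgebra b)
    (hB : IsQuadraticAlgebra K c.nicholsGrading) :
    c.envelopingIdeal b = c.quadEnvelopingIdeal (c.restrictE₂ b) := by
  refine le_antisymm (fun t ht => ?_) quadEnvelopingIdeal_le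
  obtain ⟨n, hn⟩ := exists_degProj_eq_zero t
  -- Here n is a strict bound on the degree, so that n = 0 means t = 0; this accounts for n + 1 in
  -- the final application.
  have key : ∀ n (t : TensorAlgebra K V), t ∈ c.envelopingIdeal b →
      (∀ k ≥ n, degProj K V k t = 0) → t ∈ c.quadEnvelopingIdeal (c.restrictE₂ b) := by
    intro n
    induction n with
    | zero =>
      intro t _ h
      rw [eq_zero_of_degProj fun k => h k (Nat.zero_le k)]
      exact zero_mem _
    | succ n ih =>
      intro t ht h
      obtain ⟨s, hs, hs', hst⟩ := exists_mem_quadEnvelopingIdeal (c.restrictE₂ b)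
        (mem_span_of_gamma_eq_zero hB (hb.gamma_degProj_eq_zero ht h)) n
      rw [degProj_degProj] at hst
      rw [← sub_add_cancel t s]
      -- The difference t - s stays in the enveloping ideal, as s is in the smaller one, and its
      -- degree n component cancels.
      refine add_mem (ih _ (sub_mem ht (quadEnvelopingIdeal_le hs)) fun k hk => ?_) hs
      rw [map_sub]
      rcases (Nat.lt_or_eq_of_le hk) with hk | rfl
      · rw [h k hk, hs' k hk, sub_zero]
      · rw [hst, sub_self]
  exact key (n + 1) t ht hn

/-! ### The quadratic bracket -/

theorem braidTV_ι₂ (z : V ⊗[K] V) (w : V) :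
    c.braidTV (ι₂ K V z ⊗ₜ w) = (ι₂ K V).lTensor V
      (c.head V (c.c.lTensor V (TensorProduct.assoc K V V V (z ⊗ₜ w)))) := by
  induction z with
  | zero => simp
  | add x y hx hy => simp only [map_add, add_tmul, hx, hy]
  | tmul u v =>
    rw [ι₂_tmul, braidTV_ι_mul, ← braidWith_apply, braidWith_ι, assoc_tmul, LinearMap.lTensor_tmul,
      ι₂, LinearMap.lTensor_comp, LinearMap.comp_apply, head_naturality, LinearMap.lTensor_tmul]

theorem braidVT_ι₂ (v : V) (z : V ⊗[K] V) :
    c.braidVT (v ⊗ₜ ι₂ K V z) = (ι₂ K V).rTensor V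
      ((TensorProduct.assoc K V V V).symm (c.c.lTensor V (c.head V (v ⊗ₜ z)))) := by
  induction z with
  | zero => simp
  | add x y hx hy => simp only [map_add, tmul_add, hx, hy]
  | tmul u w =>
    rw [ι₂_tmul, braidVT_ι_mul, head_tmul, head_tmul]
    generalize c.c (v ⊗ₜ u) = t
    induction t with
    | zero => simp
    | add a b ha hb => simp only [map_add, add_tmul, ha, hb]
    | tmul a d =>
      rw [assoc_tmul, assoc_tmul, LinearMap.lTensor_tmul, LinearMap.lTensor_tmul, braidVT_ι]
      generalize c.c (d ⊗ₜ w) = t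
      induction t with
      | zero => simp
      | add a b ha hb => simp only [map_add, tmul_add, ha, hb]
      | tmul m n => simp

/-- The restricted bracket is b composed with j : E₂ → E. As c_T is given on V ⊗ V by the composites
of c₁ and c₂ that define c_{E₂,V} and c_{V,E₂}, j intertwines the braidings, and its squares paste
with those of b. -/
theorem IsBracket.isQBracket (hb : c.IsBracket b) : c.IsQBracket (c.restrictE₂ b) := by
  let j : c.E₂ →ₗ[K] c.E :=
    (ι₂ K V ∘ₗ c.E₂.subtype).codRestrict c.E fun z => c.ι₂_mem_E z.2
  have hj : c.E.subtype ∘ₗ j = ι₂ K V ∘ₗ c.E₂.subtype := rfl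
  have hβ : c.restrictE₂ b = b ∘ₗ j := rfl
  have hl : c.braidEV ∘ₗ j.rTensor V = j.lTensor V ∘ₗ c.braidE₂V := by
    apply TensorProduct.ext'
    intro z w
    -- The restricted braidings are known only after inclusion into T(V), so the comparison is made
    -- in V ⊗ T(V).
    apply lTensor_subtype_injective c.E
    rw [LinearMap.comp_apply, LinearMap.comp_apply, lTensor_comp_apply, hj, LinearMap.lTensor_comp,
      LinearMap.comp_apply, braidEV, lTensor_subtype_restrictRight, braidE₂V,
      lTensor_subtype_restrictRight]
    exact braidTV_ι₂ z.1 w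
  have hr : c.braidVE ∘ₗ j.lTensor V = j.rTensor V ∘ₗ c.braidVE₂ := by
    apply TensorProduct.ext'
    intro v z
    apply rTensor_subtype_injective c.E
    rw [LinearMap.comp_apply, LinearMap.comp_apply, ← LinearMap.comp_apply (c.E.subtype.rTensor V)
      (j.rTensor V), ← LinearMap.rTensor_comp, hj, LinearMap.rTensor_comp,
      LinearMap.comp_apply, braidVE, rTensor_subtype_restrictLeft, braidVE₂,
      rTensor_subtype_restrictLeft]
    exact braidVT_ι₂ v z.1
  constructor
  · rw [hβ, LinearMap.rTensor_comp, ← LinearMap.comp_assoc, hb.left, LinearMap.comp_assoc, hl,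
      LinearMap.lTensor_comp, LinearMap.comp_assoc]
  · rw [hβ, LinearMap.lTensor_comp, ← LinearMap.comp_assoc, hb.right, LinearMap.comp_assoc, hr,
      LinearMap.rTensor_comp, LinearMap.comp_assoc]

/-! ### The Jacobi identity -/

/-- On (E₂ ⊗ V) ∩ (V ⊗ E₂) both c₁ and c₂ act as -1, so their composites act as the identity:
c_{E₂,V} sends x to y and c_{V,E₂} sends y to x. By the bracket identities c then exchanges (β ⊗ V)x
and (V ⊗ β)y, so it negates their difference. -/
theorem IsQBracket.sub_mem_E₂ {β : c.E₂ →ₗ[K] V} (hβ : c.IsQBracket β) {x : c.E₂ ⊗[K] V}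
    {y : V ⊗[K] c.E₂}
    (h : TensorProduct.assoc K V V V (c.E₂.subtype.rTensor V x) = c.E₂.subtype.lTensor V y) :
    β.rTensor V x - β.lTensor V y ∈ c.E₂ := by
  have hx : ∀ x : c.E₂ ⊗[K] V, c.head V (TensorProduct.assoc K V V V (c.E₂.subtype.rTensor V x)) =
      -TensorProduct.assoc K V V V (c.E₂.subtype.rTensor V x) := by
    intro x
    induction x with
    | zero => simp
    | add a b ha hb => simp only [map_add, ha, hb]; abel
    | tmul z w => simp [head, (c.mem_E₂).mp z.2, neg_tmul]
  have hl : c.braidE₂V x = y := by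
    apply lTensor_subtype_injective c.E₂
    rw [braidE₂V, lTensor_subtype_restrictRight]
    simp only [LinearMap.comp_apply, LinearEquiv.coe_coe]
    rw [h, lTensor_c_of_E₂, map_neg, ← h, hx, neg_neg]
  have hr : c.braidVE₂ y = x := by
    apply rTensor_subtype_injective c.E₂
    rw [braidVE₂, rTensor_subtype_restrictLeft]
    simp only [LinearMap.comp_apply, LinearEquiv.coe_coe]
    rw [← h, hx, map_neg, h, lTensor_c_of_E₂, neg_neg, ← h, LinearEquiv.symm_apply_apply]
  have e₁ := LinearMap.congr_fun hβ.left x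
  have e₂ := LinearMap.congr_fun hβ.right y
  rw [LinearMap.comp_apply, LinearMap.comp_apply, hl] at e₁
  rw [LinearMap.comp_apply, LinearMap.comp_apply, hr] at e₂
  rw [mem_E₂, map_sub, e₁, e₂, neg_sub]

theorem projU_ι₂ (z : c.E₂) :
    c.projU b (ι₂ K V z) = c.projU b (ι K (c.restrictE₂ b z)) :=
  projU_coe_E ⟨ι₂ K V z, c.ι₂_mem_E z.2⟩

/-- Jacobi holds because U is associative and contains V: evaluating a cubic tensor in U with β
applied to its first two or to its last two letters gives the same element, the image of the tensor
itself. -/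
theorem IsBraidedLieAlgebra.isQLieAlgebra (hb : c.IsBraidedLieAlgebra b) :
    c.IsQLieAlgebra (c.restrictE₂ b) where
  isQBracket := hb.isBracket.isQBracket
  jacobi x y h := by
    have hmem := hb.isBracket.isQBracket.sub_mem_E₂ h
    refine ⟨hmem, hb.inclU_injective ?_⟩
    let p : V ⊗[K] (V ⊗[K] V) →ₗ[K] TensorAlgebra K V := lmul K V ∘ₗ (ι₂ K V).lTensor V
    have hx : ∀ x : c.E₂ ⊗[K] V, c.projU b (ι₂ K V ((c.restrictE₂ b).rTensor V x)) =
        c.projU b (p (TensorProduct.assoc K V V V (c.E₂.subtype.rTensor V x))) := by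
      intro x
      induction x with
      | zero => simp
      | add a b ha hb => simp only [map_add, ha, hb]
      | tmul z w =>
        have e : ∀ t : V ⊗[K] V, p (TensorProduct.assoc K V V V (t ⊗ₜ w)) =
            ι₂ K V t * ι K w := by
          intro t
          induction t with
          | zero => simp
          | add a b ha hb => simp only [map_add, add_tmul, add_mul, ha, hb]
          | tmul a b => simp [p, mul_assoc]
        rw [LinearMap.rTensor_tmul, LinearMap.rTensor_tmul, Submodule.subtype_apply, e, ι₂_tmul,
          map_mul, map_mul, projU_ι₂]
    have hy : ∀ y : V ⊗[K] c.E₂, c.projU b (ι₂ K V ((c.restrictE₂ b).lTensor V y)) =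
        c.projU b (p (c.E₂.subtype.lTensor V y)) := by
      intro y
      induction y with
      | zero => simp
      | add a b ha hb => simp only [map_add, ha, hb]
      | tmul v z =>
        rw [LinearMap.lTensor_tmul, LinearMap.lTensor_tmul, Submodule.subtype_apply, ι₂_tmul,
          map_mul, ← projU_ι₂]
        simp [p]
    rw [map_zero]
    change c.projU b (ι K _) = 0
    -- In U the value β(d) equals d itself, and the two halves of d have the same image by h.
    rw [← projU_ι₂, map_sub, map_sub, hx, hy, h, sub_self]

end Braiding

/-! ### Conclusion -/

/-- Stated for variable ideals so that the equality can be substituted; the isomorphism is then the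
identity. -/
theorem TwoSidedIdeal.exists_quotient_algEquiv_of_eq {R A : Type*} [CommRing R] [Ring A]
    [Algebra R A] {I J : TwoSidedIdeal A} (h : I = J) :
    ∃ e : I.ringCon.Quotient ≃ₐ[R] J.ringCon.Quotient,
      ∀ t, e (I.ringCon.mkₐ R t) = J.ringCon.mkₐ R t := by
  subst h
  exact ⟨AlgEquiv.refl, fun _ => rfl⟩

end

theorem mainTheorem1 {K : Type*} [Field K] {V : Type*} [AddCommGroup V] [Module K V]
    (c : Braiding K V) (b : c.E →ₗ[K] V) (hb : c.IsBraidedLieAlgebra b)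
    (hB : IsQuadraticAlgebra K c.nicholsGrading) :
    c.IsQLieAlgebra (c.restrictE₂ b) ∧
      c.envelopingIdeal b = c.quadEnvelopingIdeal (c.restrictE₂ b) ∧
      ∃ e : c.UQ (c.restrictE₂ b) ≃ₐ[K] c.U b,
        ∀ t : TensorAlgebra K V, e (c.projUQ (c.restrictE₂ b) t) = c.projU b t :=
  have h := hb.envelopingIdeal_eq hB
  ⟨hb.isQLieAlgebra, h, TwoSidedIdeal.exists_quotient_algEquiv_of_eq h.symm⟩
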